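/- **Theorem 1.2.** Let $A=\lim_{n\to\infty}\frac{1^1 2^2\cdots n^n}{n^{n^2/2+n/2+1/12}e^{-n^2/4}}$ be the Glaisher–Kinkelin constant and let $G$ be the Barnes $G$-function, $$G(z+1)=(2\pi)^{z/2}\exp\Big(-\frac{z(z+1)}2-\frac{\gamma_{E} z^2}2\Big)\prod_{k=1}^\infty\Big[\Big(1+\frac zk\Big)^k\exp\Big(-z+\frac{z^2}{2k}\Big)\Big],$$ where $\gamma_E$ is the Euler–Mascheroni constant. Asymptotic expansions are meant in the sense of Poincaré: $f\sim\sum_{k\ge0}c_kx^{-k}$ means $f-\sum_{k<m}c_kx^{-k}=O(x^{-m})$ for every integer $m\ge0$; such an expansion determines its constant coefficients $c_k$. There are (unique) real numbers $\gamma_0,\gamma_1,\dots$, the Stirling coefficients, with $$\nu!\sim\Big(\frac{\nu}{e}\Big)^{\nu}\sqrt{2\pi\nu}\,\sum_{k\ge0}\frac{\gamma_k}{\nu^k}\qquad(\nu\to\infty,\ \nu\in\mathbb N),$$ and for every real $r\ne0$ there are (unique) real numbers $b_0(r)=1,b_1(r),b_2(r),\dots$ with $$G(z+1)\sim A^{-1}z^{-\frac12z^2-\frac12z-\frac1{12}}\,e^{z^2/4}\,\Gamma(z+1)^z\Big(1+\sum_{n\ge1}\frac{b_n(r)}{z^{2n}}\Big)^{1/r}\qquad(z\to+\infty,\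 z\in\mathbb R),$$ meaning that the $r$-th power of the quotient of $G(z+1)$ by $A^{-1}z^{-z^2/2-z/2-1/12}e^{z^2/4}\Gamma(z+1)^z$ has the asymptotic expansion $\sum_{n\ge0}b_n(r)z^{-2n}$. These coefficients satisfy $$b_n(r)\sim(-1)^n r(2n-1)\Big(\frac{n-1}{\pi e}\Big)^{2n-2}\sqrt{\frac{n-1}{\pi^7}}\;\sum_{k\ge0}\frac{I_{k,n}(r)}{(n-1)^k}\qquad(n\to\infty),$$ that is, with $P_n(r)=(-1)^n r(2n-1)\big(\frac{n-1}{\pi e}\big)^{2n-2}\sqrt{\frac{n-1}{\pi^7}}$, for every fixed integer $m\ge0$ $$b_n(r)=P_n(r)\Big(\sum_{k=0}^{m-1}\frac{I_{k,n}(r)}{(n-1)^k}+O\big((n-1)^{-m}\big)\Big)\qquad(n\to\infty),$$ where the implied constant may depend on $r$ and $m$. Here $I_{0,n}(r)=\frac14$ and, for $k\ge1$, $$I_{k,n}(r)=\frac{\gamma_k}{2^{k+2}}+\frac1{2n-1}\sum_{j=1}^{k}\ \sum_{\nu=1}^{\lfloor (j+1)/2\rfloor}(-1)^\nu\,2^{2\nu-k-2}\,\pi^{2\nu}\,b_\nu(r)\,\gamma_{k-j}\,S(j-1,2\nu-2),$$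 with $S(\cdot,\cdot)$ the Stirling numbers of the second kind. -/

import Mathlib

open Filter Asymptotics

noncomputable section

/-- The (Poincaré) asymptotic expansion `f ∼ ∑_{k ≥ 0} c k / x ^ k` along the filter `l`, where
`x` is a function tending to infinity along `l`: for every `m`, the error of the partial sum of
the terms of index `k < m` is `O(x ^ (-m))`. -/
def HasAsymptoticExpansion {α : Type*} (l : Filter α) (f x : α → ℝ) (c : ℕ → ℝ) : Prop :=
  ∀ m : ℕ, (fun t => f t - ∑ k ∈ Finset.range m, c k / x t ^ k) =O[l] fun t => 1 / x t ^ m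

/-- The coefficients of an asymptotic expansion are determined by the function, so that one may
speak of *the* coefficients. -/
theorem HasAsymptoticExpansion.unique {α : Type*} {l : Filter α} [l.NeBot] {f x : α → ℝ}
    (hx : Tendsto x l atTop) {c d : ℕ → ℝ} (hc : HasAsymptoticExpansion l f x c)
    (hd : HasAsymptoticExpansion l f x d) : c = d := by
  funext n
  induction n using Nat.strong_induction_on with
  | _ n ih =>
    have h1 := (hd (n + 1)).sub (hc (n + 1))
    have h2 : (fun t => (c n - d n) * (1 / x t ^ n)) =O[l] fun t => 1 / x t ^ (n + 1) := by
      refine h1.congr_left fun t => ?_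
      have hs : ∑ k ∈ Finset.range n, c k / x t ^ k = ∑ k ∈ Finset.range n, d k / x t ^ k :=
        Finset.sum_congr rfl fun k hk => by rw [ih k (Finset.mem_range.mp hk)]
      rw [Finset.sum_range_succ, Finset.sum_range_succ, hs]
      ring
    have h3 : (fun _ : α => c n - d n) =O[l] fun t => (x t)⁻¹ := by
      refine ((isBigO_refl (fun t => x t ^ n) l).mul h2).congr' ?_ ?_
      · filter_upwards [hx.eventually_gt_atTop 0] with t ht
        field_simp
      · filter_upwards [hx.eventually_gt_atTop 0] with t ht
        rw [pow_succ]
        field_simp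
    have h4 : Tendsto (fun _ : α => c n - d n) l (nhds 0) :=
      h3.trans_tendsto (tendsto_inv_atTop_zero.comp hx)
    exact sub_eq_zero.mp (tendsto_nhds_unique tendsto_const_nhds h4)

/-- `γ` is the sequence of Stirling coefficients:
`ν! ∼ (ν / e) ^ ν * √(2 π ν) * ∑_{n ≥ 0} γ n / ν ^ n` as `ν → ∞`. -/
def IsStirlingCoeff (γ : ℕ → ℝ) : Prop :=
  HasAsymptoticExpansion (atTop : Filter ℕ)
    (fun ν => (ν.factorial : ℝ) /
      (((ν : ℝ) / Real.exp 1) ^ ν * Real.sqrt (2 * Real.pi * (ν : ℝ))))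
    (fun ν => (ν : ℝ)) γ

/-- The Barnes G-function at real arguments, by its Weierstrass product
`G (z + 1) = (2 π) ^ (z / 2) * exp (-z (z + 1) / 2 - γ z² / 2) *
∏_{k ≥ 1} (1 + z / k) ^ k * exp (-z + z² / (2 k))`, `γ` the Euler–Mascheroni constant;
the product is written with `k + 1` in place of `k`, and `z + 1` is the argument. -/
def barnesG (s : ℝ) : ℝ :=
  let z : ℝ := s - 1
  (2 * Real.pi) ^ (z / 2) *
    Real.exp (-(z * (z + 1) / 2) - Real.eulerMascheroniConstant * z ^ 2 / 2) *
    ∏' k : ℕ, ((1 + z / ((k : ℝ) + 1)) ^ (k + 1) *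
      Real.exp (-z + z ^ 2 / (2 * ((k : ℝ) + 1))))

/-- The Glaisher–Kinkelin constant
`A = lim 1^1 2^2 ⋯ n^n / (n ^ (n² / 2 + n / 2 + 1 / 12) * exp (-n² / 4)) = 1.28242…`. -/
def glaisherKinkelin : ℝ :=
  limUnder atTop fun n : ℕ =>
    (∏ k ∈ Finset.Icc 1 n, (k : ℝ) ^ k) /
      ((n : ℝ) ^ ((n : ℝ) ^ 2 / 2 + (n : ℝ) / 2 + 1 / 12) * Real.exp (-((n : ℝ) ^ 2 / 4)))

/-- `b` is the sequence of coefficients `b_n(r)` in the expansion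
`G (z + 1) ∼ A⁻¹ z ^ (-z² / 2 - z / 2 - 1 / 12) e ^ (z² / 4) Γ (z + 1) ^ z *
(1 + ∑_{n ≥ 1} b n / z ^ (2 n)) ^ (1 / r)` of the Barnes G-function as `z → +∞`, that is,
the `r`-th power of the quotient of `G (z + 1)` by the factor in front has the asymptotic
expansion `∑_{n ≥ 0} b n / z ^ (2 n)` with `b 0 = 1`. -/
def IsBarnesCoeff (r : ℝ) (b : ℕ → ℝ) : Prop :=
  b 0 = 1 ∧
  HasAsymptoticExpansion (atTop : Filter ℝ)
    (fun z => (barnesG (z + 1) /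
      (glaisherKinkelin⁻¹ * z ^ (-(z ^ 2 / 2) - z / 2 - 1 / 12) * Real.exp (z ^ 2 / 4) *
        Real.Gamma (z + 1) ^ z)) ^ r)
    (fun z => z ^ 2) b

/-- The coefficients `I_{k,n}(r)`, in terms of the Stirling coefficients `γ`, the Stirling numbers
of the second kind, and the coefficients `b ν = b_ν(r)`. -/
def coeffI (γ b : ℕ → ℝ) (k n : ℕ) : ℝ :=
  if k = 0 then 1 / 4
  else γ k / 2 ^ (k + 2) + 1 / (2 * (n : ℝ) - 1) *
    ∑ j ∈ Finset.Icc 1 k, ∑ ν ∈ Finset.Icc 1 ((j + 1) / 2),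
      (-1 : ℝ) ^ ν * (2 : ℝ) ^ (2 * (ν : ℤ) - (k : ℤ) - 2) * Real.pi ^ (2 * ν) * b ν * γ (k - j) *
        (Nat.stirlingSecond (j - 1) (2 * ν - 2) : ℝ)

/-- The factor `(-1)^n r (2n - 1) ((n - 1) / (π e)) ^ (2n - 2) √((n - 1) / π ^ 7)`. -/
def leadingFactor (r : ℝ) (n : ℕ) : ℝ :=
  (-1 : ℝ) ^ n * r * (2 * (n : ℝ) - 1) *
    (((n : ℝ) - 1) / (Real.pi * Real.exp 1)) ^ (2 * n - 2) *
    Real.sqrt (((n : ℝ) - 1) / Real.pi ^ 7)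

end

/-! Euler–Maclaurin summation gives the logarithm of the Barnes quotient in closed form, as `-∑ₖ
bernoulliIntegral 1 0 (z + k)` (`barnesG_add_one_eq`, `barnesG_quotient_rpow`). Its expansion in `1
/ z` has only even powers, so `b_n(r)` is the `n`-th coefficient of the formal exponential of `∑ a_k
X ^ k` with `a_k = r (2k - 1)! B_{2k+2} / (2k + 2)!`. The same summation, started one Bernoulli
polynomial earlier, gives the Stirling coefficients as the exponential of another such series.

By Euler's formula for `ζ(2k + 2)`, `(2π) ^ (2k) a_k` is `±(2k - 1)!` up to a constant and the
factor `ζ(2k + 2)`, which is exponentially close to `1`. For coefficients growing this fast, the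
exponential is dominated by the terms with a single large index: `b_n = ∑_{ν < M} a_{n-ν} b_ν +
O((2n - 1)! / n ^ (2M))` after this scaling (`expCoeff_sub_sum_isBigO`).

It remains to expand `(2n - 2ν - 1)!`. Put `N = 2n - 2`. The term `ν = 0` is `(2n - 1) N!`. For `ν ≥
1` the quotient by `N!` is `1 / (N (N - 1) ⋯ (N - (2ν - 2)))`, whose expansion in `1 / N` has
Stirling numbers of the second kind as coefficients (`hasAsymptoticExpansion_inv_descFactorial`).
Stirling's series for `N!` supplies the `γ`, the Cauchy product of the two expansions supplies the
double sum in `I_{k,n}`, and `1 / N = (1 / 2) / (n - 1)` supplies the powers of two. -/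

noncomputable section

/-! ### Formal exponentials through the equation `E' = A' E` -/

/-- The coefficients of the formal power series `exp (∑_{k ≥ 1} a k X ^ k)`. -/
def expCoeff (a : ℕ → ℝ) : ℕ → ℝ
  | 0 => 1
  | n + 1 => (∑ i : Fin (n + 1), (((n - i : ℕ) : ℝ) + 1) * a (n - i + 1) * expCoeff a i) / (n + 1)

theorem expCoeff_zero (a : ℕ → ℝ) : expCoeff a 0 = 1 := by rw [expCoeff]

/-- Coefficient form of `E' = A' E`; the facts about the exponential below are drawn from this
recurrence. -/
theorem expCoeff_succ (a : ℕ → ℝ) (n : ℕ) :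
    ((n : ℝ) + 1) * expCoeff a (n + 1) =
      ∑ p ∈ Finset.HasAntidiagonal.antidiagonal n,
        ((p.1 : ℝ) + 1) * a (p.1 + 1) * expCoeff a p.2 := by
  rw [expCoeff, mul_div_cancel₀ _ (by positivity : (n : ℝ) + 1 ≠ 0),
    Finset.Nat.antidiagonal_eq_map', Finset.sum_map,
    Fin.sum_univ_eq_sum_range (fun i => (((n - i : ℕ) : ℝ) + 1) * a (n - i + 1) * expCoeff a i)]
  rfl

theorem sum_antidiagonal_succ_mul_two_pow (n : ℕ) :
    ∑ p ∈ Finset.HasAntidiagonal.antidiagonal n, ((p.1 : ℝ) + 1) * 2 ^ p.2 =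
      2 ^ (n + 2) - n - 3 := by
  induction n with
  | zero => norm_num
  | succ n ih =>
    rw [Finset.Nat.sum_antidiagonal_succ']
    simp only [pow_succ _ _, ← mul_assoc, ← Finset.sum_mul, ih]
    push_cast
    ring

/-- Geometric bounds on `a` give geometric bounds on the coefficients of its exponential. -/
theorem abs_expCoeff_le {a : ℕ → ℝ} {K R : ℝ} (hK : 0 ≤ K) (hR : 0 ≤ R) {n : ℕ}
    (ha : ∀ k, 1 ≤ k → k ≤ n → |a k| ≤ K * R ^ k) :
    |expCoeff a n| ≤ Real.exp (2 * K) * (2 * R) ^ n := by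
  -- The partial sums `e m` of `exp (2K)` make the induction close: by `∑ (p + 1) 2 ^ q ≤ 2 ^ (m +
  -- 2)`, a step of the recurrence costs `2K`, which `2K e m ≤ (m + 1) e (m + 1)` absorbs. Only `a
  -- k` with `k ≤ n` enter, so `R` may depend on `n`.
  set e : ℕ → ℝ := fun n => ∑ i ∈ Finset.range (n + 1), (2 * K) ^ i / i.factorial with he
  have he0 : ∀ m, 0 ≤ e m := fun m => Finset.sum_nonneg fun i _ => by positivity
  have hmono : Monotone e := monotone_nat_of_le_succ fun m => by
    rw [he]
    simp only
    rw [Finset.sum_range_succ _ (m + 1)]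
    have : 0 ≤ (2 * K) ^ (m + 1) / (m + 1).factorial := by positivity
    linarith
  have hstep : ∀ m, 2 * K * e m ≤ ((m : ℝ) + 1) * e (m + 1) := fun m => by
    rw [he]
    simp only
    rw [Finset.sum_range_succ' _ (m + 1), mul_add, Finset.mul_sum, Finset.mul_sum]
    refine le_add_of_le_of_nonneg (Finset.sum_le_sum fun i hi => ?_) (by positivity)
    have hi' : (i : ℝ) ≤ m := by exact_mod_cast Nat.lt_succ_iff.mp (Finset.mem_range.mp hi)
    have h1 : (2 * K) * ((2 * K) ^ i / i.factorial) =
        ((i : ℝ) + 1) * ((2 * K) ^ (i + 1) / (i + 1).factorial) := by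
      rw [Nat.factorial_succ]
      push_cast
      rw [pow_succ']
      field_simp
    rw [h1]
    gcongr
  have key : ∀ m, m ≤ n → |expCoeff a m| ≤ e m * (2 * R) ^ m := by
    intro m
    induction m using Nat.strong_induction_on with
    | _ m ih =>
      intro hmn
      rcases m with _ | m
      · simp [expCoeff_zero, he]
      · have h1 : ((m : ℝ) + 1) * |expCoeff a (m + 1)| ≤
            ∑ p ∈ Finset.HasAntidiagonal.antidiagonal m,
              (K * e m * R ^ (m + 1)) * (((p.1 : ℝ) + 1) * 2 ^ p.2) := by
          have hpos : (0 : ℝ) ≤ (m : ℝ) + 1 := by positivity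
          have habs : ((m : ℝ) + 1) * |expCoeff a (m + 1)| =
              |((m : ℝ) + 1) * expCoeff a (m + 1)| := by rw [abs_mul, abs_of_nonneg hpos]
          rw [habs, expCoeff_succ]
          refine (Finset.abs_sum_le_sum_abs _ _).trans (Finset.sum_le_sum fun p hp => ?_)
          have hp' : p.1 + p.2 = m := Finset.HasAntidiagonal.mem_antidiagonal.mp hp
          rw [abs_mul, abs_mul, abs_of_nonneg (by positivity : (0 : ℝ) ≤ (p.1 : ℝ) + 1)]
          calc ((p.1 : ℝ) + 1) * |a (p.1 + 1)| * |expCoeff a p.2|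
              ≤ ((p.1 : ℝ) + 1) * (K * R ^ (p.1 + 1)) * (e m * (2 * R) ^ p.2) := by
                gcongr
                · exact ha _ (by omega) (by omega)
                · refine (ih p.2 (by omega) (by omega)).trans ?_
                  gcongr
                  exact hmono (by omega)
            _ = _ := by
                rw [← hp', mul_pow]
                ring
        rw [← Finset.mul_sum, sum_antidiagonal_succ_mul_two_pow] at h1
        have h2 : K * e m * R ^ (m + 1) * (2 ^ (m + 2) - m - 3) ≤
            (2 * K * e m) * (2 * R) ^ (m + 1) := by
          have : (2 * K * e m) * (2 * R) ^ (m + 1) = K * e m * R ^ (m + 1) * 2 ^ (m + 2) := by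
            rw [mul_pow]; ring
          rw [this]
          have := he0 m
          gcongr
          have : (0 : ℝ) ≤ m := by positivity
          linarith
        have h3 : (2 * K * e m) * (2 * R) ^ (m + 1) ≤
            ((m : ℝ) + 1) * e (m + 1) * (2 * R) ^ (m + 1) := by
          exact mul_le_mul_of_nonneg_right (hstep m) (by positivity)
        have h4 := h1.trans (h2.trans h3)
        rw [mul_assoc] at h4
        exact le_of_mul_le_mul_left h4 (by positivity)
  refine (key n le_rfl).trans ?_
  gcongr
  exact Real.sum_le_exp_of_nonneg (by positivity) _

open PowerSeries in
theorem derivative_mk_expCoeff (a : ℕ → ℝ) :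
    d⁄dX ℝ (PowerSeries.mk (expCoeff a)) =
      d⁄dX ℝ (PowerSeries.mk a) * PowerSeries.mk (expCoeff a) := by
  ext n
  rw [coeff_derivative, coeff_mk, mul_comm, expCoeff_succ, coeff_mul]
  refine Finset.sum_congr rfl fun p _ => ?_
  rw [coeff_derivative, coeff_mk, coeff_mk]
  ring

-- Uniqueness for the linear equation `D' = A D` modulo `X ^ K`: the recurrence determines each
-- coefficient from the earlier ones, and these all vanish.
open PowerSeries in
theorem PowerSeries.coeff_eq_zero_of_dvd_derivative_sub {A D : ℝ⟦X⟧} {K : ℕ}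
    (h0 : coeff 0 D = 0) (h : X ^ K ∣ d⁄dX ℝ D - A * D) {m : ℕ} (hm : m ≤ K) :
    coeff m D = 0 := by
  induction m using Nat.strong_induction_on with
  | _ m ih =>
    rcases m with _ | m
    · exact h0
    · have h1 := X_pow_dvd_iff.mp h m (by omega)
      rw [map_sub, coeff_derivative, coeff_mul, Finset.sum_eq_zero, sub_zero] at h1
      · exact (mul_eq_zero.mp h1).resolve_right (by positivity)
      · intro p hp
        have hp' : p.1 + p.2 = m := Finset.HasAntidiagonal.mem_antidiagonal.mp hp
        rw [ih p.2 (by omega) (by omega), mul_zero]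

open PowerSeries in
/-- Separating the terms of index at most `N` from the others in the exponential of a power
series: the square of the second part does not contribute to coefficients of index at
most `2 N + 1`. -/
theorem expCoeff_eq_truncation_add (a : ℕ → ℝ) {N n : ℕ} (hn : n ≤ 2 * N + 1) :
    expCoeff a n = expCoeff (fun k => if k ≤ N then a k else 0) n +
      ∑ p ∈ Finset.HasAntidiagonal.antidiagonal n, (if p.1 ≤ N then 0 else a p.1) *
        expCoeff (fun k => if k ≤ N then a k else 0) p.2 := by
  set u : ℕ → ℝ := fun k => if k ≤ N then a k else 0 with hu
  set V : ℝ⟦X⟧ := PowerSeries.mk fun k => if k ≤ N then 0 else a k with hV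
  set U : ℝ⟦X⟧ := PowerSeries.mk (expCoeff u) with hU
  have hsum : PowerSeries.mk a = PowerSeries.mk u + V := by
    ext k
    simp only [hu, hV, map_add, coeff_mk]
    split_ifs <;> simp
  have hVd : X ^ (N + 1) ∣ V := X_pow_dvd_iff.mpr fun m hm => by
    rw [hV, coeff_mk, if_pos (by omega)]
  have hVd' : X ^ N ∣ d⁄dX ℝ V := X_pow_dvd_iff.mpr fun m hm => by
    rw [coeff_derivative, hV, coeff_mk, if_pos (by omega), zero_mul]
  -- With `E` the full exponential, the defect `E - (1 + V) U` satisfies the equation up to `V' V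
  -- U`. The factors `V'` and `V` are divisible by `X ^ N` and `X ^ (N + 1)`.
  have hode : X ^ (2 * N + 1) ∣
      d⁄dX ℝ (PowerSeries.mk (expCoeff a) - (1 + V) * U) -
        d⁄dX ℝ (PowerSeries.mk a) * (PowerSeries.mk (expCoeff a) - (1 + V) * U) := by
    have : d⁄dX ℝ (PowerSeries.mk (expCoeff a) - (1 + V) * U) -
        d⁄dX ℝ (PowerSeries.mk a) * (PowerSeries.mk (expCoeff a) - (1 + V) * U) =
        (d⁄dX ℝ V * V) * U := by
      rw [map_sub, derivative_mk_expCoeff a, Derivation.leibniz, derivative_mk_expCoeff u,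
        hsum, map_add, map_add]
      simp only [smul_eq_mul, ← hU, Derivation.map_one_eq_zero]
      ring
    rw [this, show 2 * N + 1 = N + (N + 1) by ring, pow_add]
    exact (mul_dvd_mul hVd' hVd).mul_right _
  have h0 : coeff 0 (PowerSeries.mk (expCoeff a) - (1 + V) * U) = 0 := by
    have hV0 : constantCoeff V = 0 := by
      rw [← coeff_zero_eq_constantCoeff_apply, hV, coeff_mk, if_pos (Nat.zero_le _)]
    have hU0 : constantCoeff U = 1 := by
      rw [← coeff_zero_eq_constantCoeff_apply, hU, coeff_mk, expCoeff_zero]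
    rw [map_sub, coeff_mk, expCoeff_zero, coeff_zero_eq_constantCoeff_apply]
    simp [hV0, hU0]
  have h := PowerSeries.coeff_eq_zero_of_dvd_derivative_sub h0 hode hn
  rw [map_sub, coeff_mk, sub_eq_zero] at h
  rw [h, add_mul, one_mul, map_add, hU, coeff_mk, coeff_mul]
  simp only [hV, coeff_mk]

theorem expCoeff_truncation (a : ℕ → ℝ) {N n : ℕ} (hn : n ≤ N) :
    expCoeff (fun k => if k ≤ N then a k else 0) n = expCoeff a n := by
  rw [expCoeff_eq_truncation_add a (show n ≤ 2 * N + 1 by omega), Finset.sum_eq_zero, add_zero]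
  intro p hp
  have := Finset.HasAntidiagonal.mem_antidiagonal.mp hp
  rw [if_pos (by omega), zero_mul]

/-- Cutting at `n / 2` leaves at most one large index per term; its cofactor has index `ν ≤ n / 2`,
where truncation changes nothing. -/
theorem expCoeff_eq_half_truncation_add (a : ℕ → ℝ) (n : ℕ) :
    expCoeff a n = expCoeff (fun k => if k ≤ n / 2 then a k else 0) n +
      ∑ ν ∈ Finset.range (n - n / 2), a (n - ν) * expCoeff a ν := by
  rw [expCoeff_eq_truncation_add a (show n ≤ 2 * (n / 2) + 1 by omega)]
  congr 1
  rw [Finset.Nat.antidiagonal_eq_map', Finset.sum_map]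
  have hsub : Finset.range (n - n / 2) ⊆ Finset.range (n + 1) :=
    Finset.range_subset_range.mpr (by omega)
  rw [← Finset.sum_subset hsub]
  · refine Finset.sum_congr rfl fun ν hν => ?_
    have := Finset.mem_range.mp hν
    change (if n - ν ≤ n / 2 then 0 else a (n - ν)) *
      expCoeff (fun k => if k ≤ n / 2 then a k else 0) ν = _
    rw [if_neg (by omega), expCoeff_truncation a (by omega)]
  · intro ν hν hν'
    have h1 := Finset.mem_range.mp hν
    have h2 : ¬ ν < n - n / 2 := fun h => hν' (Finset.mem_range.mpr h)
    change (if n - ν ≤ n / 2 then 0 else a (n - ν)) * _ = _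
    rw [if_pos (by omega), zero_mul]

/-! ### Exponentials of series with factorially growing coefficients -/

theorem factorial_le_two_mul_half_pow {m : ℕ} (hm : 1 ≤ m) :
    (m.factorial : ℝ) ≤ 2 * ((m : ℝ) / 2) ^ m := by
  induction m, hm using Nat.le_induction with
  | base => norm_num
  | succ m hm ih =>
    have hm0 : (0 : ℝ) < m := by exact_mod_cast hm
    have hb : 2 * (m : ℝ) ^ m ≤ ((m : ℝ) + 1) ^ m := by
      have h1 := one_add_mul_le_pow (a := 1 / (m : ℝ)) (by have : 0 < 1 / (m : ℝ) := by positivity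
                                                           linarith) m
      have h2 : (1 : ℝ) + m * (1 / m) = 2 := by field_simp; norm_num
      rw [h2] at h1
      calc 2 * (m : ℝ) ^ m ≤ (1 + 1 / (m : ℝ)) ^ m * (m : ℝ) ^ m := by gcongr
        _ = _ := by rw [← mul_pow]; congr 1; field_simp
    rw [Nat.factorial_succ]
    push_cast
    calc ((m : ℝ) + 1) * m.factorial ≤ ((m : ℝ) + 1) * (2 * ((m : ℝ) / 2) ^ m) := by gcongr
      _ = ((m : ℝ) + 1) * (2 * (m : ℝ) ^ m) / 2 ^ m := by rw [div_pow]; ring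
      _ ≤ ((m : ℝ) + 1) * ((m : ℝ) + 1) ^ m / 2 ^ m := by gcongr
      _ = _ := by rw [div_pow]; ring

theorem pow_div_exp_one_le_factorial (m : ℕ) : ((m : ℝ) / Real.exp 1) ^ m ≤ m.factorial := by
  have h := Real.pow_div_factorial_le_exp (m : ℝ) (by positivity) m
  rw [div_le_iff₀ (by positivity)] at h
  rw [div_pow, ← Real.exp_nat_mul, mul_one, div_le_iff₀ (Real.exp_pos _), mul_comm]
  exact h

/-- The `2ν` factors removed from `(2n - 1)!` are all at least `2n - 2ν ≥ n`. -/
theorem factorial_sub_mul_pow_le {n ν : ℕ} (hn : 1 ≤ n) (h : 2 * ν ≤ n) :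
    ((2 * n - 2 * ν - 1).factorial : ℝ) * (n : ℝ) ^ (2 * ν) ≤ (2 * n - 1).factorial := by
  have h1 := Nat.factorial_mul_descFactorial (show 2 * ν ≤ 2 * n - 1 by omega)
  have h2 := Nat.pow_sub_le_descFactorial (2 * n - 1) (2 * ν)
  have h3 : n ^ (2 * ν) ≤ (2 * n - 1 + 1 - 2 * ν) ^ (2 * ν) := Nat.pow_le_pow_left (by omega) _
  rw [show 2 * n - 2 * ν - 1 = 2 * n - 1 - 2 * ν by omega]
  exact_mod_cast h1 ▸ Nat.mul_le_mul_left _ (h3.trans h2)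

/-- If `a k = O((2 k - 1)!)`, then the coefficients `b` of the exponential of `∑ a k X ^ k` satisfy
`b n = ∑_{ν < M} a (n - ν) b ν + O((2 n - 1)! / n ^ (2 M))`. -/
theorem expCoeff_sub_sum_isBigO {a : ℕ → ℝ} {K : ℝ}
    (ha : ∀ k, 1 ≤ k → |a k| ≤ K * (2 * k - 1).factorial) (M : ℕ) :
    (fun n : ℕ => expCoeff a n - ∑ ν ∈ Finset.range M, a (n - ν) * expCoeff a ν) =O[atTop]
      fun n : ℕ => ((2 * n - 1).factorial : ℝ) / (n : ℝ) ^ (2 * M) := by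
  have hK : 0 ≤ K := by
    have := (abs_nonneg _).trans (ha 1 le_rfl)
    simpa using this
  have ha' : ∀ k, 1 ≤ k → |a k| ≤ 2 * K * ((k : ℝ) ^ 2) ^ k := fun k hk => by
    have h1 : ((2 * k - 1).factorial : ℝ) ≤ (2 * k).factorial := by
      exact_mod_cast Nat.factorial_le (by omega)
    have h2 := factorial_le_two_mul_half_pow (show 1 ≤ 2 * k by omega)
    push_cast at h2
    rw [mul_div_cancel_left₀ _ (by norm_num : (2 : ℝ) ≠ 0), pow_mul] at h2
    calc |a k| ≤ K * (2 * k - 1).factorial := ha k hk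
      _ ≤ K * (2 * ((k : ℝ) ^ 2) ^ k) := by gcongr; exact h1.trans h2
      _ = _ := by ring
  set C : ℝ := Real.exp (2 * (2 * K)) with hC
  have hb : ∀ ν : ℕ, |expCoeff a ν| ≤ C * (2 * (ν : ℝ) ^ 2) ^ ν := fun ν =>
    abs_expCoeff_le (by positivity) (by positivity) fun k hk hkν => (ha' k hk).trans (by gcongr)
  have hu : ∀ n : ℕ, |expCoeff (fun k => if k ≤ n / 2 then a k else 0) n| ≤
      C * (2 * ((n : ℝ) / 2) ^ 2) ^ n := fun n => by
    refine abs_expCoeff_le (by positivity) (by positivity) fun k hk _ => ?_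
    split_ifs with h
    · refine (ha' k hk).trans ?_
      have : (k : ℝ) ≤ n / 2 := by
        rw [le_div_iff₀ (by norm_num)]
        exact_mod_cast (Nat.le_div_iff_mul_le (by norm_num)).mp h
      gcongr
    · rw [abs_zero]; positivity
  have hs1 : Summable fun ν : ℕ => (2 : ℝ) ^ (2 * M) * ((ν : ℝ) ^ (2 * M) * (1 / 2) ^ ν) :=
    (summable_pow_mul_geometric_of_norm_lt_one (R := ℝ) (2 * M) (r := 1 / 2)
      (by norm_num)).mul_left _
  -- The truncated exponential is at most `C (n² / 2) ^ n`, while `(2n)! ≥ (4n² / e²) ^ n`. The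
  -- ratio `(e² / 8) ^ n` decays geometrically; without cutting at `n / 2` this bound would give
  -- `(e² / 2) ^ n`, which grows.
  have hlt : Real.exp 1 ^ 2 / 8 < 1 := by
    have := Real.exp_one_lt_d9
    have h0 := Real.exp_pos 1
    rw [div_lt_one (by norm_num)]
    nlinarith
  have hs2 : Summable fun ν : ℕ => (ν : ℝ) ^ (2 * M + 1) * (Real.exp 1 ^ 2 / 8) ^ ν :=
    summable_pow_mul_geometric_of_norm_lt_one (R := ℝ) (2 * M + 1)
      (by rwa [Real.norm_of_nonneg (by positivity)])
  obtain ⟨C2, hC2⟩ : ∃ C2, ∀ n : ℕ, (n : ℝ) ^ (2 * M + 1) * (Real.exp 1 ^ 2 / 8) ^ n ≤ C2 :=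
    ⟨_, fun n => hs2.le_tsum n fun i _ => by positivity⟩
  refine IsBigO.of_bound (C * (2 * C2) +
    K * C * ∑' ν : ℕ, (2 : ℝ) ^ (2 * M) * ((ν : ℝ) ^ (2 * M) * (1 / 2) ^ ν)) ?_
  filter_upwards [eventually_ge_atTop (2 * M + 1)] with n hn
  have hn0 : (0 : ℝ) < n := by exact_mod_cast (show 0 < n by omega)
  have hsplit : expCoeff a n - ∑ ν ∈ Finset.range M, a (n - ν) * expCoeff a ν =
      expCoeff (fun k => if k ≤ n / 2 then a k else 0) n +
        ∑ ν ∈ Finset.Ico M (n - n / 2), a (n - ν) * expCoeff a ν := by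
    rw [expCoeff_eq_half_truncation_add a n,
      ← Finset.sum_range_add_sum_Ico _ (show M ≤ n - n / 2 by omega)]
    ring
  rw [hsplit, Real.norm_eq_abs, Real.norm_of_nonneg (by positivity), add_mul]
  refine (abs_add_le _ _).trans (add_le_add ?_ ?_)
  · refine (hu n).trans ?_
    have h1 := pow_div_exp_one_le_factorial (2 * n)
    have h2 : ((2 * n).factorial : ℝ) = 2 * n * (2 * n - 1).factorial := by
      rw [← Nat.mul_factorial_pred (show 2 * n ≠ 0 by omega)]
      push_cast; ring
    rw [h2] at h1
    have h3 := hC2 n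
    have hC20 : 0 ≤ C2 := le_trans (by positivity) h3
    rw [mul_assoc, ← mul_div_assoc]
    gcongr
    rw [le_div_iff₀ (by positivity)]
    refine le_of_mul_le_mul_left ?_ (show (0 : ℝ) < 2 * n by positivity)
    calc 2 * (n : ℝ) * ((2 * ((n : ℝ) / 2) ^ 2) ^ n * (n : ℝ) ^ (2 * M))
        = 2 * ((n : ℝ) ^ (2 * M + 1) * (Real.exp 1 ^ 2 / 8) ^ n) *
            (((2 * n : ℕ) : ℝ) / Real.exp 1) ^ (2 * n) := by
          have : (2 * ((n : ℝ) / 2) ^ 2) ^ n =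
              (Real.exp 1 ^ 2 / 8) ^ n * (((2 * n : ℕ) : ℝ) / Real.exp 1) ^ (2 * n) := by
            rw [pow_mul, ← mul_pow]
            congr 1
            push_cast
            field_simp
            ring
          rw [this]
          ring
      _ ≤ 2 * C2 * (2 * n * (2 * n - 1).factorial) := by gcongr
      _ = _ := by ring
  · calc |∑ ν ∈ Finset.Ico M (n - n / 2), a (n - ν) * expCoeff a ν|
        ≤ ∑ ν ∈ Finset.Ico M (n - n / 2), K * C * (((2 * n - 1).factorial : ℝ) / n ^ (2 * M)) *
            ((2 : ℝ) ^ (2 * M) * ((ν : ℝ) ^ (2 * M) * (1 / 2) ^ ν)) := by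
          refine (Finset.abs_sum_le_sum_abs _ _).trans (Finset.sum_le_sum fun ν hν => ?_)
          obtain ⟨hν1, hν2⟩ := Finset.mem_Ico.mp hν
          have hνn : 2 * ν ≤ n := by omega
          have hfac := factorial_sub_mul_pow_le (show 1 ≤ n by omega) hνn
          -- Since `2ν ≤ n`, all but `2M` of the factors `2ν` in the bound for `b_ν` are replaced by
          -- `n`. They cancel against `n ^ (2ν)` from the factorials, up to `n ^ (-2M)`, and leave
          -- the summable `ν ^ (2M) / 2 ^ ν`.
          have hpow : (2 * (ν : ℝ)) ^ (2 * ν) ≤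
              (2 * (ν : ℝ)) ^ (2 * M) * (n : ℝ) ^ (2 * ν - 2 * M) := by
            have : (2 * (ν : ℝ)) ^ (2 * ν) =
                (2 * (ν : ℝ)) ^ (2 * M) * (2 * (ν : ℝ)) ^ (2 * ν - 2 * M) := by
              rw [← pow_add]
              congr 1
              omega
            rw [this]
            gcongr
            exact_mod_cast hνn
          have hbν : (2 * (ν : ℝ) ^ 2) ^ ν = (2 * (ν : ℝ)) ^ (2 * ν) * (1 / 2) ^ ν := by
            rw [pow_mul, ← mul_pow]
            congr 1
            ring
          have hsq : (n : ℝ) ^ (2 * ν) = (n : ℝ) ^ (2 * M) * (n : ℝ) ^ (2 * ν - 2 * M) := by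
            rw [← pow_add]
            congr 1
            omega
          have han := ha (n - ν) (by omega)
          rw [Nat.mul_sub] at han
          rw [abs_mul]
          calc |a (n - ν)| * |expCoeff a ν|
              ≤ (K * (2 * n - 2 * ν - 1).factorial) * (C * (((2 * (ν : ℝ)) ^ (2 * M) *
                  (n : ℝ) ^ (2 * ν - 2 * M)) * (1 / 2) ^ ν)) := by
                gcongr
                refine (hb ν).trans ?_
                rw [hbν]
                gcongr
            _ = K * C * (((2 * n - 2 * ν - 1).factorial * (n : ℝ) ^ (2 * ν)) / n ^ (2 * M)) *
                  ((2 : ℝ) ^ (2 * M) * ((ν : ℝ) ^ (2 * M) * (1 / 2) ^ ν)) := by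
                rw [hsq, mul_pow]
                field_simp
            _ ≤ _ := by gcongr
      _ ≤ _ := by
          rw [← Finset.mul_sum, mul_right_comm]
          gcongr
          exact hs1.sum_le_tsum _ fun i _ => by positivity

/-! ### Euler–Maclaurin remainders and difference equations -/

/-- The normalised integral `q! / (q + d + 1)! * ∫_0^1 B_{q + d + 1}(x) / (z + x) ^ (q + 1) dx` of
the Euler–Maclaurin remainder on a unit interval. -/
def bernoulliIntegral (d q : ℕ) (z : ℝ) : ℝ :=
  (q.factorial : ℝ) / (q + d + 1).factorial *
    ∫ x in (0 : ℝ)..1, bernoulliFun (q + d + 1) x / (z + x) ^ (q + 1)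

/-- The coefficients of the Euler–Maclaurin expansion belonging to `bernoulliIntegral d 0`. -/
def eulerMaclaurinCoeff (d : ℕ) : ℕ → ℝ
  | 0 => 0
  | q + 1 => (q.factorial : ℝ) * bernoulli (q + d + 2) / (q + d + 2).factorial

theorem integral_bernoulliFun_div_pow_by_parts (j p : ℕ) (hj : 1 ≤ j) {z : ℝ} (hz : 0 < z) :
    ((j : ℝ) + 1) * ∫ x in (0 : ℝ)..1, bernoulliFun j x / (z + x) ^ p =
      bernoulli (j + 1) * (1 / (z + 1) ^ p - 1 / z ^ p) +
        p * ∫ x in (0 : ℝ)..1, bernoulliFun (j + 1) x / (z + x) ^ (p + 1) := by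
  have hpos : ∀ x ∈ Set.uIcc (0 : ℝ) 1, z + x ≠ 0 := fun x hx => by
    rw [Set.uIcc_of_le zero_le_one] at hx
    have := hx.1
    positivity
  have hint : ∀ i q : ℕ, IntervalIntegrable (fun x => bernoulliFun i x / (z + x) ^ q)
      MeasureTheory.volume 0 1 := fun i q => by
    refine ContinuousOn.intervalIntegrable ?_
    refine (continuous_bernoulliFun i).continuousOn.div (by fun_prop) fun x hx => ?_
    exact pow_ne_zero _ (hpos x hx)
  have hderiv : ∀ x ∈ Set.uIcc (0 : ℝ) 1,
      HasDerivAt (fun x => bernoulliFun (j + 1) x / (z + x) ^ p)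
        (((j : ℝ) + 1) * (bernoulliFun j x / (z + x) ^ p) -
          p * (bernoulliFun (j + 1) x / (z + x) ^ (p + 1))) x := fun x hx => by
    have hne := hpos x hx
    have h1 := hasDerivAt_bernoulliFun (j + 1) x
    have h2 : HasDerivAt (fun x => (z + x) ^ p) (p * (z + x) ^ (p - 1) * 1) x :=
      ((hasDerivAt_id x).const_add z).pow p
    convert! h1.div h2 (pow_ne_zero _ hne) using 1
    rcases p with _ | p
    · simp
    · simp only [Nat.add_sub_cancel]
      push_cast
      field_simp
      ring
  have hFTC := intervalIntegral.integral_eq_sub_of_hasDerivAt hderiv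
    (((hint j p).const_mul _).sub ((hint (j + 1) (p + 1)).const_mul _))
  rw [intervalIntegral.integral_sub ((hint j p).const_mul _) ((hint (j + 1) (p + 1)).const_mul _),
    intervalIntegral.integral_const_mul, intervalIntegral.integral_const_mul,
    bernoulliFun_endpoints_eq_of_ne_one (by omega), bernoulliFun_eval_zero, add_zero] at hFTC
  linear_combination hFTC

/-- The normalising factorials make integration by parts leave the next integral with coefficient
`1`. The boundary term is a difference in `z`, so it telescopes along `z + n`. -/
theorem bernoulliIntegral_step (d q : ℕ) {z : ℝ} (hz : 0 < z) :
    bernoulliIntegral d q z =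
      eulerMaclaurinCoeff d (q + 1) * (1 / (z + 1) ^ (q + 1) - 1 / z ^ (q + 1)) +
        bernoulliIntegral d (q + 1) z := by
  have h := integral_bernoulliFun_div_pow_by_parts (q + d + 1) (q + 1) (by omega) hz
  rw [bernoulliIntegral, bernoulliIntegral, eulerMaclaurinCoeff,
    show q + 1 + d + 1 = q + d + 1 + 1 by ring, show q + d + 2 = q + d + 1 + 1 by ring,
    Nat.factorial_succ (q + d + 1), Nat.factorial_succ q]
  push_cast at h ⊢
  generalize 1 / (z + 1) ^ (q + 1) - 1 / z ^ (q + 1) = u at h ⊢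
  field_simp
  linear_combination h

theorem bernoulliIntegral_eq_sum_add (d K : ℕ) {z : ℝ} (hz : 0 < z) :
    bernoulliIntegral d 0 z = ∑ k ∈ Finset.range (K + 1), (eulerMaclaurinCoeff d k / (z + 1) ^ k -
      eulerMaclaurinCoeff d k / z ^ k) + bernoulliIntegral d K z := by
  induction K with
  | zero => simp
  | succ K ih =>
    rw [ih, bernoulliIntegral_step d K hz, Finset.sum_range_succ _ (K + 1)]
    ring

theorem exists_abs_bernoulliIntegral_le (d q : ℕ) :
    ∃ C, 0 ≤ C ∧ ∀ z : ℝ, 0 < z → |bernoulliIntegral d q z| ≤ C / z ^ (q + 1) := by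
  obtain ⟨B, hB⟩ := isCompact_Icc.exists_bound_of_continuousOn
    (s := Set.Icc (0 : ℝ) 1) (continuous_bernoulliFun (q + d + 1)).continuousOn
  have hB0 : 0 ≤ B := (norm_nonneg _).trans (hB 0 (by simp))
  refine ⟨(q.factorial : ℝ) / (q + d + 1).factorial * B, by positivity, fun z hz => ?_⟩
  rw [bernoulliIntegral, abs_mul, abs_of_nonneg (by positivity), mul_div_assoc]
  gcongr
  have h := intervalIntegral.norm_integral_le_of_norm_le_const (a := (0 : ℝ)) (b := 1)
    (f := fun x => bernoulliFun (q + d + 1) x / (z + x) ^ (q + 1)) (C := B / z ^ (q + 1)) ?_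
  · simpa using h
  · intro x hx
    rw [Set.uIoc_of_le zero_le_one] at hx
    have hx0 := hx.1
    rw [norm_div, norm_pow, Real.norm_of_nonneg (by positivity : 0 ≤ z + x)]
    have := hB x ⟨hx0.le, hx.2⟩
    gcongr
    linarith

/-- Subtracting a partial sum `S` of the expansion from `h` turns the increments into high-order
remainders. As `h - S` tends to `0` along `x + n`, its initial value is bounded by the sum of their
absolute values. -/
theorem hasAsymptoticExpansion_of_sub_eq_bernoulliIntegral {α : Type*} {l : Filter α} {x : α → ℝ}
    (hx : Tendsto x l atTop) {h : α → ℕ → ℝ} {d : ℕ}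
    (hh : ∀ᶠ t in l, (∀ n : ℕ, h t (n + 1) - h t n = bernoulliIntegral d 0 (x t + n)) ∧
      Tendsto (h t) atTop (nhds 0)) :
    HasAsymptoticExpansion l (fun t => h t 0) x (eulerMaclaurinCoeff d) := by
  intro m
  obtain ⟨C, hC0, hC⟩ := exists_abs_bernoulliIntegral_le d (m + 1)
  -- Two terms beyond index `m - 1` give increments `O((x + n) ^ (-(m + 2)))`: `m` powers go into `x
  -- ^ (-m)`, two pay for summation over `n`. The extra terms are themselves `O(x ^ (-m))`.
  set S : ℝ → ℝ := fun z => ∑ k ∈ Finset.range (m + 2), eulerMaclaurinCoeff d k / z ^ k with hS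
  have hs : Summable fun n : ℕ => 1 / ((n : ℝ) + 1) ^ 2 := by
    have := (summable_nat_add_iff 1).mpr (Real.summable_one_div_nat_pow.mpr one_lt_two)
    simpa using this
  have hmain : ∀ᶠ t in l, |h t 0 - S (x t)| ≤ C * (∑' n : ℕ, 1 / ((n : ℝ) + 1) ^ 2) / x t ^ m := by
    filter_upwards [hh, hx.eventually_ge_atTop 1] with t ⟨ht1, ht2⟩ hxt
    have hx0 : 0 < x t := by linarith
    have hSlim : Tendsto (fun n : ℕ => S (x t + n)) atTop (nhds 0) := by
      have : Tendsto (fun n : ℕ => x t + n) atTop atTop :=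
        tendsto_atTop_add_const_left _ _ tendsto_natCast_atTop_atTop
      have h0 : (0 : ℝ) = ∑ k ∈ Finset.range (m + 2), (0 : ℝ) := by simp
      rw [h0]
      refine tendsto_finsetSum _ fun k _ => ?_
      rcases k with _ | k
      · simp [eulerMaclaurinCoeff]
      · exact tendsto_const_nhds.div_atTop ((tendsto_pow_atTop (by omega)).comp this)
    have hdiff : ∀ n : ℕ, |(h t (n + 1) - S (x t + (n + 1 : ℕ))) - (h t n - S (x t + n))| ≤
        C / x t ^ m * (1 / ((n : ℝ) + 1) ^ 2) := fun n => by
      have hpos : 0 < x t + n := by positivity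
      have h1 := bernoulliIntegral_eq_sum_add d (m + 1) hpos
      rw [Finset.sum_sub_distrib] at h1
      have h2 : (h t (n + 1) - S (x t + (n + 1 : ℕ))) - (h t n - S (x t + n)) =
          bernoulliIntegral d (m + 1) (x t + n) := by
        simp only [hS]
        push_cast
        rw [← add_assoc]
        linear_combination ht1 n + h1
      rw [h2]
      refine (hC _ hpos).trans ?_
      rw [div_mul_div_comm, mul_one, show m + 1 + 1 = m + 2 by ring, pow_add]
      have hn0 : (0 : ℝ) ≤ n := n.cast_nonneg
      exact div_le_div_of_nonneg_left hC0 (by positivity)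
        (mul_le_mul (pow_le_pow_left₀ hx0.le (by linarith) m)
          (pow_le_pow_left₀ (by positivity) (by linarith) 2) (by positivity) (by positivity))
    have hN : ∀ N : ℕ, |(h t N - S (x t + N)) - (h t 0 - S (x t))| ≤
        C / x t ^ m * ∑' n : ℕ, 1 / ((n : ℝ) + 1) ^ 2 := fun N => by
      have htel := Finset.sum_range_sub (fun n : ℕ => h t n - S (x t + n)) N
      simp only [Nat.cast_zero, add_zero] at htel
      rw [← htel]
      refine (Finset.abs_sum_le_sum_abs _ _).trans
        ((Finset.sum_le_sum fun n _ => hdiff n).trans ?_)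
      rw [← Finset.mul_sum]
      gcongr
      exact hs.sum_le_tsum _ fun i _ => by positivity
    have hlim := ((ht2.sub hSlim).sub_const (h t 0 - S (x t))).abs
    rw [sub_zero, zero_sub, abs_neg] at hlim
    refine (le_of_tendsto' hlim hN).trans (le_of_eq ?_)
    ring
  have h1 : (fun t => h t 0 - S (x t)) =O[l] fun t => 1 / x t ^ m := by
    refine IsBigO.of_bound (C * ∑' n : ℕ, 1 / ((n : ℝ) + 1) ^ 2) ?_
    filter_upwards [hmain, hx.eventually_gt_atTop 0] with t ht hxt
    rw [Real.norm_eq_abs, Real.norm_of_nonneg (by positivity), mul_one_div]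
    exact ht
  have h2 : (fun t => eulerMaclaurinCoeff d m / x t ^ m +
      eulerMaclaurinCoeff d (m + 1) / x t ^ (m + 1)) =O[l] fun t => 1 / x t ^ m := by
    refine IsBigO.of_bound (|eulerMaclaurinCoeff d m| + |eulerMaclaurinCoeff d (m + 1)|) ?_
    filter_upwards [hx.eventually_ge_atTop 1] with t hxt
    have hx0 : 0 < x t := by linarith
    rw [Real.norm_eq_abs, Real.norm_of_nonneg (by positivity), add_mul, mul_one_div, mul_one_div]
    refine (abs_add_le _ _).trans ?_
    rw [abs_div, abs_div, abs_of_nonneg (by positivity : 0 ≤ x t ^ m),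
      abs_of_nonneg (by positivity : 0 ≤ x t ^ (m + 1))]
    gcongr
    · omega
  refine (h1.add h2).congr_left fun t => ?_
  simp only [hS]
  rw [Finset.sum_range_succ _ (m + 1), Finset.sum_range_succ _ m]
  ring

theorem bernoulliIntegral_zero_zero {z : ℝ} (hz : 0 < z) :
    bernoulliIntegral 0 0 z = 1 - (z + 1 / 2) * (Real.log (z + 1) - Real.log z) := by
  have hpos : ∀ x ∈ Set.uIcc (0 : ℝ) 1, z + x ≠ 0 := fun x hx => by
    rw [Set.uIcc_of_le zero_le_one] at hx
    have := hx.1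
    positivity
  have hderiv : ∀ x ∈ Set.uIcc (0 : ℝ) 1,
      HasDerivAt (fun x => x - (z + 1 / 2) * Real.log (z + x))
        (bernoulliFun 1 x / (z + x) ^ 1) x := fun x hx => by
    have hne := hpos x hx
    convert! (hasDerivAt_id x).sub
      ((((hasDerivAt_id x).const_add z).log hne).const_mul (z + 1 / 2)) using 1
    rw [bernoulliFun_one]
    simp only [id]
    field_simp
    ring
  have hint : IntervalIntegrable (fun x => bernoulliFun 1 x / (z + x) ^ 1)
      MeasureTheory.volume 0 1 :=
    ContinuousOn.intervalIntegrable <| (continuous_bernoulliFun 1).continuousOn.div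
      (by fun_prop) fun x hx => pow_ne_zero _ (hpos x hx)
  rw [bernoulliIntegral]
  simp only [zero_add]
  rw [intervalIntegral.integral_eq_sub_of_hasDerivAt hderiv hint]
  simp
  ring

theorem bernoulliIntegral_one_zero {z : ℝ} (hz : 0 < z) :
    bernoulliIntegral 1 0 z =
      (z ^ 2 / 2 + z / 2 + 1 / 12) * (Real.log (z + 1) - Real.log z) - (2 * z + 1) / 4 := by
  have hpos : ∀ x ∈ Set.uIcc (0 : ℝ) 1, z + x ≠ 0 := fun x hx => by
    rw [Set.uIcc_of_le zero_le_one] at hx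
    have := hx.1
    positivity
  -- Division of `B₂(x) = x² - x + 1/6` by `z + x` has quotient `x - (z + 1)` and remainder `B₂(-z)
  -- = z² + z + 1/6`.
  have hderiv : ∀ x ∈ Set.uIcc (0 : ℝ) 1,
      HasDerivAt (fun x => x ^ 2 / 2 - (z + 1) * x + (z ^ 2 + z + 1 / 6) * Real.log (z + x))
        (bernoulliFun 2 x / (z + x) ^ 1) x := fun x hx => by
    have hne := hpos x hx
    convert! (((hasDerivAt_pow 2 x).div_const 2).sub ((hasDerivAt_id x).const_mul (z + 1))).add
      ((((hasDerivAt_id x).const_add z).log hne).const_mul (z ^ 2 + z + 1 / 6)) using 1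
    rw [bernoulliFun_two]
    simp only [id]
    field_simp
    ring
  have hint : IntervalIntegrable (fun x => bernoulliFun 2 x / (z + x) ^ 1)
      MeasureTheory.volume 0 1 :=
    ContinuousOn.intervalIntegrable <| (continuous_bernoulliFun 2).continuousOn.div
      (by fun_prop) fun x hx => pow_ne_zero _ (hpos x hx)
  rw [bernoulliIntegral]
  simp only [zero_add, Nat.reduceAdd]
  rw [intervalIntegral.integral_eq_sub_of_hasDerivAt hderiv hint]
  simp
  ring

/-! ### Calculus of asymptotic expansions -/

/-- The polynomial `∑_{k < m} a k X ^ k`. -/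
def truncPolynomial (a : ℕ → ℝ) (m : ℕ) : Polynomial ℝ :=
  ∑ k ∈ Finset.range m, Polynomial.monomial k (a k)

theorem coeff_truncPolynomial (a : ℕ → ℝ) (m k : ℕ) :
    (truncPolynomial a m).coeff k = if k < m then a k else 0 := by
  rw [truncPolynomial, Polynomial.finsetSum_coeff]
  simp [Polynomial.coeff_monomial]

theorem eval_truncPolynomial_inv (a : ℕ → ℝ) (m : ℕ) (x : ℝ) :
    (truncPolynomial a m).eval x⁻¹ = ∑ k ∈ Finset.range m, a k / x ^ k := by
  rw [truncPolynomial, Polynomial.eval_finsetSum]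
  refine Finset.sum_congr rfl fun k _ => ?_
  rw [Polynomial.eval_monomial, inv_pow, div_eq_mul_inv]

theorem tendsto_eval_inv {α : Type*} {l : Filter α} {x : α → ℝ} (hx : Tendsto x l atTop)
    (p : Polynomial ℝ) : Tendsto (fun t => p.eval (x t)⁻¹) l (nhds (p.eval 0)) :=
  (p.continuous.tendsto 0).comp (tendsto_inv_atTop_zero.comp hx)

theorem isBigO_eval_inv_of_X_pow_dvd {α : Type*} {l : Filter α} {x : α → ℝ}
    (hx : Tendsto x l atTop) {p : Polynomial ℝ} {m : ℕ} (hp : Polynomial.X ^ m ∣ p) :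
    (fun t => p.eval (x t)⁻¹) =O[l] fun t => 1 / x t ^ m := by
  obtain ⟨q, rfl⟩ := hp
  have h := (isBigO_refl (fun t => 1 / x t ^ m) l).mul ((tendsto_eval_inv hx q).isBigO_one ℝ)
  refine h.congr (fun t => ?_) fun t => mul_one _
  rw [Polynomial.eval_mul, Polynomial.eval_pow, Polynomial.eval_X, inv_pow, one_div]

namespace HasAsymptoticExpansion

variable {α β : Type*} {l : Filter α} {f g x : α → ℝ} {a b : ℕ → ℝ}

theorem sub_eval_truncPolynomial (h : HasAsymptoticExpansion l f x a) (m : ℕ) :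
    (fun t => f t - (truncPolynomial a m).eval (x t)⁻¹) =O[l] fun t => 1 / x t ^ m := by
  simp only [eval_truncPolynomial_inv]
  exact h m

theorem isBigO_one (h : HasAsymptoticExpansion l f x a) : f =O[l] fun _ => (1 : ℝ) := by
  simpa using h 0

theorem tendsto (h : HasAsymptoticExpansion l f x a) (hx : Tendsto x l atTop) :
    Tendsto f l (nhds (a 0)) := by
  have h1 := h 1
  simp only [Finset.range_one, Finset.sum_singleton, pow_zero, div_one, pow_one, one_div] at h1
  have h2 := h1.trans_tendsto (tendsto_inv_atTop_zero.comp hx)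
  simpa using h2.add_const (a 0)

theorem congr' (h : HasAsymptoticExpansion l f x a) (hfg : f =ᶠ[l] g) :
    HasAsymptoticExpansion l g x a := fun m =>
  (h m).congr' (hfg.mono fun t ht => by simp only [ht]) EventuallyEq.rfl

theorem comp_tendsto (h : HasAsymptoticExpansion l f x a) {k : Filter β} {u : β → α}
    (hu : Tendsto u k l) : HasAsymptoticExpansion k (f ∘ u) (x ∘ u) a := fun m =>
  (h m).comp_tendsto hu

theorem const_mul (h : HasAsymptoticExpansion l f x a) (c : ℝ) :
    HasAsymptoticExpansion l (fun t => c * f t) x (fun k => c * a k) := fun m => by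
  refine ((h m).const_mul_left c).congr_left fun t => ?_
  rw [mul_sub, Finset.mul_sum]
  simp only [mul_div_assoc]

theorem mul (hf : HasAsymptoticExpansion l f x a) (hg : HasAsymptoticExpansion l g x b)
    (hx : Tendsto x l atTop) :
    HasAsymptoticExpansion l (fun t => f t * g t) x
      (fun k => ∑ p ∈ Finset.HasAntidiagonal.antidiagonal k, a p.1 * b p.2) := fun m => by
  set P := truncPolynomial a m
  set Q := truncPolynomial b m
  have h1 := (hf.sub_eval_truncPolynomial m).mul hg.isBigO_one
  have h2 := ((tendsto_eval_inv hx P).isBigO_one ℝ).mul (hg.sub_eval_truncPolynomial m)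
  have h3 := isBigO_eval_inv_of_X_pow_dvd hx (m := m) (p := P * Q - truncPolynomial
      (fun k => ∑ p ∈ Finset.HasAntidiagonal.antidiagonal k, a p.1 * b p.2) m) <|
    Polynomial.X_pow_dvd_iff.mpr fun d hd => by
      rw [Polynomial.coeff_sub, Polynomial.coeff_mul, coeff_truncPolynomial, if_pos hd, sub_eq_zero]
      refine Finset.sum_congr rfl fun p hp => ?_
      have := Finset.HasAntidiagonal.mem_antidiagonal.mp hp
      rw [coeff_truncPolynomial, coeff_truncPolynomial, if_pos (by omega), if_pos (by omega)]
  simp only [one_mul, mul_one] at h1 h2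
  refine ((h1.add h2).add h3).congr_left fun t => ?_
  have h4 := eval_truncPolynomial_inv
    (fun k => ∑ p ∈ Finset.HasAntidiagonal.antidiagonal k, a p.1 * b p.2) m (x t)
  rw [Polynomial.eval_sub, Polynomial.eval_mul]
  linear_combination -h4

theorem sum {ι : Type*} (s : Finset ι) {F : ι → α → ℝ} {A : ι → ℕ → ℝ}
    (h : ∀ i ∈ s, HasAsymptoticExpansion l (F i) x (A i)) :
    HasAsymptoticExpansion l (fun t => ∑ i ∈ s, F i t) x (fun k => ∑ i ∈ s, A i k) := fun m => by
  refine (IsBigO.fun_sum fun i hi => h i hi m).congr_left fun t => ?_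
  rw [Finset.sum_sub_distrib, Finset.sum_comm]
  simp only [Finset.sum_div]

/-- An expansion in `x` without odd terms is an expansion in `x ^ 2`. -/
theorem sq (h : HasAsymptoticExpansion l f x a) (ha : ∀ k, a (2 * k + 1) = 0) :
    HasAsymptoticExpansion l f (fun t => x t ^ 2) (fun k => a (2 * k)) := fun m => by
  refine (h (2 * m)).congr (fun t => ?_) fun t => by rw [pow_mul]
  congr 1
  induction m with
  | zero => simp
  | succ m ih =>
    rw [Nat.mul_succ, Finset.sum_range_succ, Finset.sum_range_succ, Finset.sum_range_succ, ih,
      ha, zero_div, add_zero, pow_mul]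

theorem const_mul_variable (h : HasAsymptoticExpansion l f x a) {c : ℝ} (hc : 0 < c) :
    HasAsymptoticExpansion l f (fun t => c * x t) (fun k => c ^ k * a k) := fun m => by
  have h1 := (h m).trans (isBigO_const_mul_self (c ^ m) (fun t => 1 / (c * x t) ^ m) l |>.congr_left
    fun t => show _ = 1 / x t ^ m by rw [mul_pow]; field_simp)
  refine h1.congr_left fun t => ?_
  congr 1
  refine Finset.sum_congr rfl fun k _ => ?_
  rw [mul_pow]
  field_simp

end HasAsymptoticExpansion

/-- `exp (∑_{k < m + 1} a k y ^ k) = ∑_{k < m + 1} b k y ^ k + O(y ^ (m + 1))` with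
`b = expCoeff a`. -/
theorem exists_abs_exp_eval_sub_le {a : ℕ → ℝ} (ha : a 0 = 0) (m : ℕ) :
    ∃ C, ∀ y : ℝ, 0 ≤ y → y ≤ 1 →
      |Real.exp ((truncPolynomial a (m + 1)).eval y) -
        (truncPolynomial (expCoeff a) (m + 1)).eval y| ≤ C * y ^ (m + 1) := by
  set P := truncPolynomial a (m + 1) with hP
  set B := truncPolynomial (expCoeff a) (m + 1) with hB
  -- The truncated exponential `B` solves `B' = P' B` modulo `X ^ m`. Hence `B exp (-P)` has
  -- derivative `O(y ^ m)` and differs from its value `1` at `0` by `O(y ^ (m + 1))`.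
  obtain ⟨S, hS⟩ : Polynomial.X ^ m ∣ B.derivative - P.derivative * B :=
    Polynomial.X_pow_dvd_iff.mpr fun d hd => by
      rw [Polynomial.coeff_sub, Polynomial.coeff_derivative, Polynomial.coeff_mul, hB,
        coeff_truncPolynomial, if_pos (by omega), mul_comm, expCoeff_succ, sub_eq_zero]
      refine Finset.sum_congr rfl fun p hp => ?_
      have := Finset.HasAntidiagonal.mem_antidiagonal.mp hp
      rw [Polynomial.coeff_derivative, hP, coeff_truncPolynomial, coeff_truncPolynomial,
        if_pos (by omega), if_pos (by omega)]
      ring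
  obtain ⟨D, hD⟩ := isCompact_Icc.exists_bound_of_continuousOn (s := Set.Icc (0 : ℝ) 1)
    (f := fun y => S.eval y * Real.exp (-P.eval y))
    (by have := S.continuous; have := P.continuous; fun_prop)
  obtain ⟨E, hE⟩ := isCompact_Icc.exists_bound_of_continuousOn (s := Set.Icc (0 : ℝ) 1)
    (f := fun y => Real.exp (P.eval y)) (by have := P.continuous; fun_prop)
  have hD0 : 0 ≤ D := (norm_nonneg _).trans (hD 0 (by simp))
  have hE0 : 0 ≤ E := (norm_nonneg _).trans (hE 0 (by simp))
  refine ⟨E * D, fun y hy0 hy1 => ?_⟩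
  have hderiv : ∀ s ∈ Set.Icc (0 : ℝ) y, HasDerivWithinAt
      (fun s => B.eval s * Real.exp (-P.eval s)) (s ^ m * (S.eval s * Real.exp (-P.eval s)))
      (Set.Icc 0 y) s := fun s _ => by
    have h1 := (B.hasDerivAt s).mul (P.hasDerivAt s).neg.exp
    have h2 := congrArg (Polynomial.eval s) hS
    simp only [Polynomial.eval_sub, Polynomial.eval_mul, Polynomial.eval_pow,
      Polynomial.eval_X] at h2
    refine HasDerivAt.hasDerivWithinAt ?_
    convert! h1 using 1
    simp only [Pi.neg_apply]
    linear_combination -Real.exp (-P.eval s) * h2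
  have hbound : ∀ s ∈ Set.Ico (0 : ℝ) y,
      ‖s ^ m * (S.eval s * Real.exp (-P.eval s))‖ ≤ y ^ m * D := fun s hs => by
    have hs0 := hs.1
    have hs1 := hs.2
    rw [norm_mul, norm_pow, Real.norm_of_nonneg hs0]
    gcongr
    exact hD s ⟨hs0, by linarith⟩
  have h := norm_image_sub_le_of_norm_deriv_le_segment' hderiv hbound y ⟨hy0, le_rfl⟩
  have hP0 : P.eval 0 = 0 := by
    rw [← Polynomial.coeff_zero_eq_eval_zero, hP, coeff_truncPolynomial, if_pos (by omega), ha]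
  have hB0 : B.eval 0 = 1 := by
    rw [← Polynomial.coeff_zero_eq_eval_zero, hB, coeff_truncPolynomial, if_pos (by omega),
      expCoeff_zero]
  simp only [hP0, hB0, neg_zero, Real.exp_zero, mul_one, sub_zero] at h
  have hfac : Real.exp (P.eval y) - B.eval y =
      -(Real.exp (P.eval y) * (B.eval y * Real.exp (-P.eval y) - 1)) := by
    have : Real.exp (P.eval y) * Real.exp (-P.eval y) = 1 := by rw [← Real.exp_add]; simp
    linear_combination B.eval y * this
  rw [hfac, abs_neg, abs_mul]
  calc |Real.exp (P.eval y)| * |B.eval y * Real.exp (-P.eval y) - 1|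
      ≤ E * (y ^ m * D * y) := by
        gcongr
        · exact hE y ⟨hy0, hy1⟩
        · exact h
    _ = _ := by ring

theorem HasAsymptoticExpansion.exp {α : Type*} {l : Filter α} {f x : α → ℝ} {a : ℕ → ℝ}
    (h : HasAsymptoticExpansion l f x a) (hx : Tendsto x l atTop) (ha : a 0 = 0) :
    HasAsymptoticExpansion l (fun t => Real.exp (f t)) x (expCoeff a) := by
  intro m
  rcases m with _ | m
  · simpa using (((Real.continuous_exp.tendsto _).comp (h.tendsto hx)).isBigO_one ℝ)
  · set P := truncPolynomial a (m + 1) with hP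
    have h0 := h.sub_eval_truncPolynomial (m + 1)
    have hlim : Tendsto (fun t => f t - P.eval (x t)⁻¹) l (nhds 0) := by
      have h1 := (h.tendsto hx).sub (tendsto_eval_inv hx P)
      rwa [← Polynomial.coeff_zero_eq_eval_zero, hP, coeff_truncPolynomial, if_pos (by omega),
        sub_self] at h1
    have h1 : (fun t => Real.exp (f t - P.eval (x t)⁻¹) - 1) =O[l] fun t => 1 / x t ^ (m + 1) := by
      have h2 : (fun u : ℝ => Real.exp u - Real.exp 0) =O[nhds 0] fun u => u - 0 :=
        (Real.hasDerivAt_exp 0).isBigO_sub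
      simp only [Real.exp_zero, sub_zero] at h2
      exact (h2.comp_tendsto hlim).trans h0
    have h2 := (((Real.continuous_exp.tendsto _).comp (tendsto_eval_inv hx P)).isBigO_one ℝ).mul h1
    obtain ⟨C, hC⟩ := exists_abs_exp_eval_sub_le ha m
    have h3 : (fun t => Real.exp (P.eval (x t)⁻¹) -
        (truncPolynomial (expCoeff a) (m + 1)).eval (x t)⁻¹) =O[l] fun t => 1 / x t ^ (m + 1) := by
      refine IsBigO.of_bound C ?_
      filter_upwards [hx.eventually_ge_atTop 1] with t ht
      have ht0 : 0 < x t := by linarith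
      have := hC (x t)⁻¹ (by positivity) (inv_le_one_of_one_le₀ ht)
      rw [Real.norm_eq_abs, Real.norm_of_nonneg (by positivity), one_div, ← inv_pow]
      exact this
    simp only [one_mul] at h2
    refine (h2.add h3).congr_left fun t => ?_
    have : Real.exp (f t) = Real.exp (P.eval (x t)⁻¹) * Real.exp (f t - P.eval (x t)⁻¹) := by
      rw [← Real.exp_add]; congr 1; ring
    simp only [Function.comp]
    rw [this, eval_truncPolynomial_inv (expCoeff a)]
    ring

/-! ### Stirling's series -/

/-- The logarithm of the quotient of `n!` by `(n / e) ^ n * √(2 π n)`. -/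
def logStirlingQuotient (n : ℕ) : ℝ :=
  Real.log (Stirling.stirlingSeq n) - Real.log (Real.sqrt Real.pi)

theorem tendsto_logStirlingQuotient : Tendsto logStirlingQuotient atTop (nhds 0) := by
  have h := Stirling.tendsto_stirlingSeq_sqrt_pi.log (by positivity)
  have h2 := h.sub_const (Real.log (Real.sqrt Real.pi))
  rw [sub_self] at h2
  exact h2

theorem log_factorial_eq {n : ℕ} (hn : 1 ≤ n) :
    Real.log n.factorial = n * Real.log n - n + Real.log n / 2 + Real.log (2 * Real.pi) / 2 +
      logStirlingQuotient n := by
  have hn0 : (0 : ℝ) < n := by exact_mod_cast hn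
  have hπ := Real.pi_pos
  rw [logStirlingQuotient, Stirling.log_stirlingSeq_formula, Real.log_sqrt hπ.le,
    Real.log_mul two_ne_zero hn0.ne', Real.log_mul two_ne_zero hπ.ne',
    Real.log_div hn0.ne' (Real.exp_ne_zero 1), Real.log_exp]
  ring

/-- The increments are those of the case `d = 0` of Euler–Maclaurin; together with the limit `0`
they determine the expansion. -/
theorem logStirlingQuotient_succ_sub {n : ℕ} (hn : 1 ≤ n) :
    logStirlingQuotient (n + 1) - logStirlingQuotient n = bernoulliIntegral 0 0 n := by
  have hn0 : (0 : ℝ) < n := by exact_mod_cast hn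
  have h1 := log_factorial_eq hn
  have h2 := log_factorial_eq (n := n + 1) (by omega)
  rw [Nat.factorial_succ, Nat.cast_mul, Real.log_mul (by positivity) (by positivity)] at h2
  push_cast at h2
  rw [bernoulliIntegral_zero_zero hn0]
  linear_combination h1 - h2

theorem isStirlingCoeff_expCoeff : IsStirlingCoeff (expCoeff (eulerMaclaurinCoeff 0)) := by
  have h1 : HasAsymptoticExpansion atTop (fun ν : ℕ => logStirlingQuotient (ν + 0))
      (fun ν : ℕ => (ν : ℝ)) (eulerMaclaurinCoeff 0) :=
    hasAsymptoticExpansion_of_sub_eq_bernoulliIntegral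
      (h := fun ν n => logStirlingQuotient (ν + n)) tendsto_natCast_atTop_atTop <| by
      filter_upwards [eventually_ge_atTop 1] with ν hν
      refine ⟨fun n => ?_, ?_⟩
      · rw [← Nat.cast_add, ← logStirlingQuotient_succ_sub (by omega), add_assoc]
      · have := (tendsto_add_atTop_iff_nat ν).mpr tendsto_logStirlingQuotient
        simpa only [add_comm] using this
  refine (h1.exp tendsto_natCast_atTop_atTop rfl).congr' ?_
  filter_upwards [eventually_ge_atTop 1] with ν hν
  have hν0 : (0 : ℝ) < ν := by exact_mod_cast hν
  have hπ := Real.pi_pos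
  have hs : 0 < Stirling.stirlingSeq ν := by
    rw [Stirling.stirlingSeq]
    positivity
  have hsq : Real.sqrt (2 * Real.pi * ν) = Real.sqrt (2 * ν) * Real.sqrt Real.pi := by
    rw [← Real.sqrt_mul (by positivity)]
    congr 1
    ring
  rw [add_zero, logStirlingQuotient, Real.exp_sub, Real.exp_log hs, Real.exp_log (by positivity),
    Stirling.stirlingSeq, hsq, div_div]
  ring

/-! ### The Glaisher–Kinkelin constant and a closed form of the Barnes function -/

theorem eulerMaclaurinCoeff_one_odd (k : ℕ) : eulerMaclaurinCoeff 1 (2 * k + 1) = 0 := by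
  rw [eulerMaclaurinCoeff, bernoulli_eq_zero_of_odd ⟨k + 1, by ring⟩ (by omega)]
  simp

/-- One integration by parts has no boundary term, because `B₃ = 0`, and it improves the decay from
`1 / z` to `1 / z²`. -/
theorem summable_bernoulliIntegral_one {z : ℝ} (hz : 0 < z) :
    Summable fun k : ℕ => bernoulliIntegral 1 0 (z + k) := by
  obtain ⟨C, hC0, hC⟩ := exists_abs_bernoulliIntegral_le 1 1
  refine Summable.of_norm_bounded_eventually_nat
    ((Real.summable_one_div_nat_pow.mpr one_lt_two).mul_left C) ?_
  filter_upwards [eventually_ge_atTop 1] with k hk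
  have hk0 : (0 : ℝ) < k := by exact_mod_cast hk
  rw [bernoulliIntegral_step 1 0 (by positivity), eulerMaclaurinCoeff_one_odd 0, zero_mul, zero_add,
    Real.norm_eq_abs, mul_one_div]
  refine (hC _ (by positivity)).trans ?_
  rw [one_add_one_eq_two]
  gcongr
  linarith

/-- The logarithm of `x ^ (x² / 2 + x / 2 + 1 / 12) * exp (-x² / 4)`. -/
def logHyperfactorialMain (x : ℝ) : ℝ :=
  (x ^ 2 / 2 + x / 2 + 1 / 12) * Real.log x - x ^ 2 / 4

theorem logHyperfactorialMain_add_one {x : ℝ} (hx : 0 < x) :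
    logHyperfactorialMain (x + 1) = logHyperfactorialMain x + (x + 1) * Real.log (x + 1) +
      bernoulliIntegral 1 0 x := by
  rw [logHyperfactorialMain, logHyperfactorialMain, bernoulliIntegral_one_zero hx]
  ring

theorem sum_mul_log_eq {z : ℝ} (hz : 0 < z) (N : ℕ) :
    ∑ k ∈ Finset.range N, (z + k + 1) * Real.log (z + k + 1) =
      logHyperfactorialMain (z + N) - logHyperfactorialMain z -
        ∑ k ∈ Finset.range N, bernoulliIntegral 1 0 (z + k) := by
  induction N with
  | zero => simp
  | succ N ih =>
    rw [Finset.sum_range_succ, ih, Finset.sum_range_succ, Nat.cast_succ, ← add_assoc,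
      logHyperfactorialMain_add_one (by positivity)]
    ring

/-- `glaisherKinkelin` is a `limUnder`, so convergence has to be proved before its value means
anything. Telescoping from `z = 1` identifies it as `exp L`, which is also why it is positive. -/
theorem tendsto_sum_mul_log_sub_and_pos :
    0 < glaisherKinkelin ∧
      Tendsto (fun N : ℕ => ∑ k ∈ Finset.range N, ((k : ℝ) + 1) * Real.log ((k : ℝ) + 1) -
        logHyperfactorialMain N) atTop (nhds (Real.log glaisherKinkelin)) := by
  set L := -logHyperfactorialMain 1 - ∑' k : ℕ, bernoulliIntegral 1 0 (1 + k) with hL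
  have hlim : Tendsto (fun N : ℕ => ∑ k ∈ Finset.range N, ((k : ℝ) + 1) * Real.log ((k : ℝ) + 1) -
        logHyperfactorialMain N) atTop (nhds L) := by
    refine (tendsto_add_atTop_iff_nat 1).mp ?_
    have h := ((summable_bernoulliIntegral_one one_pos).hasSum.tendsto_sum_nat).const_sub
      (-logHyperfactorialMain 1)
    refine h.congr fun N => ?_
    have h1 := sum_mul_log_eq one_pos N
    rw [Finset.sum_range_succ' _ N]
    push_cast
    simp only [zero_add, Real.log_one, mul_zero, add_zero]
    simp only [add_comm (1 : ℝ)] at h1 ⊢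
    linear_combination -h1
  have hexp : Tendsto (fun n : ℕ => (∏ k ∈ Finset.Icc 1 n, (k : ℝ) ^ k) /
      ((n : ℝ) ^ ((n : ℝ) ^ 2 / 2 + (n : ℝ) / 2 + 1 / 12) * Real.exp (-((n : ℝ) ^ 2 / 4))))
      atTop (nhds (Real.exp L)) := by
    refine ((Real.continuous_exp.tendsto L).comp hlim).congr' ?_
    filter_upwards [eventually_ge_atTop 1] with n hn
    have hn0 : (0 : ℝ) < n := by exact_mod_cast hn
    have hprod : (∏ k ∈ Finset.Icc 1 n, (k : ℝ) ^ k) =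
        Real.exp (∑ k ∈ Finset.range n, ((k : ℝ) + 1) * Real.log ((k : ℝ) + 1)) := by
      clear hn hn0
      induction n with
      | zero => simp
      | succ n ih =>
        rw [Finset.prod_Icc_succ_top (by omega), ih, Finset.sum_range_succ, Real.exp_add,
          ← Nat.cast_succ, Real.exp_nat_mul, Real.exp_log (by positivity)]
    rw [Function.comp_apply, Real.exp_sub, hprod, Real.rpow_def_of_pos hn0, ← Real.exp_add,
      logHyperfactorialMain]
    congr 2
    ring
  have hA : glaisherKinkelin = Real.exp L := hexp.limUnder_eq
  rw [hA, Real.log_exp]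
  exact ⟨Real.exp_pos L, hlim⟩

theorem glaisherKinkelin_pos : 0 < glaisherKinkelin := tendsto_sum_mul_log_sub_and_pos.1

theorem abs_log_one_add_sub_le {u : ℝ} (h0 : 0 ≤ u) (h1 : u ≤ 1 / 2) :
    |Real.log (1 + u) - u + u ^ 2 / 2| ≤ 2 * u ^ 3 := by
  have h := Real.abs_log_sub_add_sum_range_le (x := -u)
    (by rw [abs_neg, abs_of_nonneg h0]; linarith) 2
  rw [abs_neg, abs_of_nonneg h0, sub_neg_eq_add] at h
  simp only [Finset.sum_range_succ, Finset.sum_range_zero] at h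
  norm_num at h
  calc |Real.log (1 + u) - u + u ^ 2 / 2| ≤ u ^ 3 / (1 - u) := by
        convert h using 2
        ring
    _ ≤ _ := by
        rw [div_le_iff₀ (by linarith)]
        nlinarith [pow_nonneg h0 3]

theorem summable_log_barnesG_factor {z : ℝ} (hz : 0 < z) :
    Summable fun k : ℕ => ((k : ℝ) + 1) * Real.log (1 + z / ((k : ℝ) + 1)) - z +
      z ^ 2 / (2 * ((k : ℝ) + 1)) := by
  have hs : Summable fun n : ℕ => 1 / ((n : ℝ) + 1) ^ 2 := by
    have := (summable_nat_add_iff 1).mpr (Real.summable_one_div_nat_pow.mpr one_lt_two)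
    simpa using this
  refine Summable.of_norm_bounded_eventually_nat (hs.mul_left (2 * z ^ 3)) ?_
  filter_upwards [tendsto_natCast_atTop_atTop.eventually_ge_atTop (2 * z)] with k hk
  have hk0 : (0 : ℝ) < (k : ℝ) + 1 := by positivity
  have h := abs_log_one_add_sub_le (u := z / ((k : ℝ) + 1)) (by positivity)
    (by rw [div_le_iff₀ hk0]; linarith)
  have heq : ((k : ℝ) + 1) * Real.log (1 + z / ((k : ℝ) + 1)) - z + z ^ 2 / (2 * ((k : ℝ) + 1)) =
      ((k : ℝ) + 1) * (Real.log (1 + z / ((k : ℝ) + 1)) - z / ((k : ℝ) + 1) +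
        (z / ((k : ℝ) + 1)) ^ 2 / 2) := by
    field_simp
  rw [heq, Real.norm_eq_abs, abs_mul, abs_of_pos hk0]
  calc _ ≤ ((k : ℝ) + 1) * (2 * (z / ((k : ℝ) + 1)) ^ 3) := by gcongr
    _ = _ := by field_simp

theorem barnesG_add_one_eq_exp {z : ℝ} (hz : 0 < z) :
    barnesG (z + 1) = Real.exp (z / 2 * Real.log (2 * Real.pi) - z * (z + 1) / 2 -
      Real.eulerMascheroniConstant * z ^ 2 / 2 +
      ∑' k : ℕ, (((k : ℝ) + 1) * Real.log (1 + z / ((k : ℝ) + 1)) - z +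
        z ^ 2 / (2 * ((k : ℝ) + 1)))) := by
  have hprod := (summable_log_barnesG_factor hz).hasSum.rexp.tprod_eq
  have hfac : (Real.exp ∘ fun k : ℕ => ((k : ℝ) + 1) * Real.log (1 + z / ((k : ℝ) + 1)) - z +
      z ^ 2 / (2 * ((k : ℝ) + 1))) = fun k : ℕ => (1 + z / ((k : ℝ) + 1)) ^ (k + 1) *
        Real.exp (-z + z ^ 2 / (2 * ((k : ℝ) + 1))) := by
    funext k
    have hpos : 0 < 1 + z / ((k : ℝ) + 1) := by positivity
    have hexp : Real.exp (((k : ℝ) + 1) * Real.log (1 + z / ((k : ℝ) + 1))) =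
        (1 + z / ((k : ℝ) + 1)) ^ (k + 1) := by
      rw [← Nat.cast_succ, Real.exp_nat_mul, Nat.cast_succ, Real.exp_log hpos]
    rw [Function.comp_apply, sub_add, Real.exp_sub, hexp, div_eq_mul_inv, ← Real.exp_neg]
    congr 2
    ring
  rw [hfac] at hprod
  simp only [barnesG, add_sub_cancel_right]
  rw [hprod, Real.rpow_def_of_pos (by have := Real.pi_pos; positivity), ← Real.exp_add,
    ← Real.exp_add]
  congr 1
  ring

theorem tendsto_logHyperfactorialMain_sub {z : ℝ} (hz : 0 < z) :
    Tendsto (fun N : ℕ => logHyperfactorialMain (z + N) - logHyperfactorialMain N -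
      (z ^ 2 / 2 + 3 * z / 2 + z * N) * Real.log N + z * Real.log (z + 1 + N))
      atTop (nhds (z * (z + 1) / 2)) := by
  have hinv : Tendsto (fun N : ℕ => ((N : ℝ))⁻¹) atTop (nhds 0) :=
    tendsto_inv_atTop_zero.comp tendsto_natCast_atTop_atTop
  -- The logarithm is multiplied by a quadratic in `N`, so `log (1 + z / N)` is needed to second
  -- order; `ρ` is the remainder times `N²`, and is `O(1 / N)`.
  set ρ : ℕ → ℝ := fun N => (N : ℝ) ^ 2 *
    (Real.log (1 + z / N) - z / N + (z / N) ^ 2 / 2) with hρ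
  have hρ0 : Tendsto ρ atTop (nhds 0) := by
    refine squeeze_zero_norm' (a := fun N : ℕ => 2 * z ^ 3 * ((N : ℝ))⁻¹) ?_ ?_
    · filter_upwards [eventually_ge_atTop 1,
        tendsto_natCast_atTop_atTop.eventually_ge_atTop (2 * z)] with N hN hNz
      have hN0 : (0 : ℝ) < N := by exact_mod_cast hN
      have h := abs_log_one_add_sub_le (u := z / (N : ℝ)) (by positivity)
        (by rw [div_le_iff₀ hN0]; linarith)
      rw [hρ, Real.norm_eq_abs, abs_mul, abs_of_nonneg (by positivity : (0 : ℝ) ≤ (N : ℝ) ^ 2)]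
      calc _ ≤ (N : ℝ) ^ 2 * (2 * (z / N) ^ 3) := by gcongr
        _ = _ := by field_simp
    · simpa using hinv.const_mul (2 * z ^ 3)
  have hlog : Tendsto (fun N : ℕ => Real.log (1 + (z + 1) * ((N : ℝ))⁻¹)) atTop (nhds 0) := by
    have h := ((hinv.const_mul (z + 1)).const_add 1).log (by norm_num)
    simpa using h
  have hlim : Tendsto (fun N : ℕ => z ^ 2 + z / 2 - z ^ 2 / 4 +
      (z ^ 3 / 2 + z ^ 2 / 2 + z / 12) * ((N : ℝ))⁻¹ + (ρ N - z ^ 2 / 2) *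
        ((1 + z * ((N : ℝ))⁻¹) ^ 2 / 2 + (((N : ℝ))⁻¹ + z * ((N : ℝ))⁻¹ ^ 2) / 2 +
          ((N : ℝ))⁻¹ ^ 2 / 12) + z * Real.log (1 + (z + 1) * ((N : ℝ))⁻¹))
      atTop (nhds (z ^ 2 + z / 2 - z ^ 2 / 4 + (z ^ 3 / 2 + z ^ 2 / 2 + z / 12) * 0 +
        (0 - z ^ 2 / 2) * ((1 + z * 0) ^ 2 / 2 + (0 + z * 0 ^ 2) / 2 + 0 ^ 2 / 12) + z * 0)) :=
    ((tendsto_const_nhds.add (hinv.const_mul _)).add ((hρ0.sub_const _).mul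
      ((((((hinv.const_mul z).const_add 1).pow 2).div_const 2).add
        ((hinv.add ((hinv.pow 2).const_mul z)).div_const 2)).add ((hinv.pow 2).div_const 12)))).add
      (hlog.const_mul z)
  have hval : z ^ 2 + z / 2 - z ^ 2 / 4 + (z ^ 3 / 2 + z ^ 2 / 2 + z / 12) * 0 +
      (0 - z ^ 2 / 2) * ((1 + z * 0) ^ 2 / 2 + (0 + z * 0 ^ 2) / 2 + 0 ^ 2 / 12) + z * 0 =
      z * (z + 1) / 2 := by ring
  rw [hval] at hlim
  refine hlim.congr' ?_
  filter_upwards [eventually_ge_atTop 1] with N hN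
  have hN0 : (0 : ℝ) < N := by exact_mod_cast hN
  have h1 : Real.log (z + 1 + N) = Real.log N + Real.log (1 + (z + 1) * ((N : ℝ))⁻¹) := by
    rw [← Real.log_mul (by positivity) (by positivity)]
    congr 1
    field_simp
    ring
  have h2 : Real.log (z + N) = Real.log N + (z / N - (z / N) ^ 2 / 2 + ρ N / (N : ℝ) ^ 2) := by
    have h3 : Real.log (z + N) = Real.log N + Real.log (1 + z / N) := by
      rw [← Real.log_mul (by positivity) (by positivity)]
      congr 1
      field_simp
      ring
    rw [h3, hρ]
    field_simp
    ring
  rw [logHyperfactorialMain, logHyperfactorialMain, h1, h2]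
  generalize Real.log (1 + (z + 1) * ((N : ℝ))⁻¹) = u
  generalize ρ N = v
  field_simp
  ring

/-- The product formula of `barnesG` in closed form, with the convergent sum of the
Euler–Maclaurin remainders. -/
theorem barnesG_add_one_eq {z : ℝ} (hz : 0 < z) :
    barnesG (z + 1) = Real.exp (z * Real.log (Real.Gamma (z + 1)) - logHyperfactorialMain z -
      ∑' k : ℕ, bernoulliIntegral 1 0 (z + k) - Real.log glaisherKinkelin) := by
  have hS := (summable_log_barnesG_factor hz).hasSum.tendsto_sum_nat
  have hT := (summable_bernoulliIntegral_one hz).hasSum.tendsto_sum_nat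
  have hA := tendsto_sum_mul_log_sub_and_pos.2
  have hG := Real.BohrMollerup.tendsto_log_gamma (x := z + 1) (by linarith)
  have hγ := Real.tendsto_harmonic_sub_log
  have hs := tendsto_logStirlingQuotient
  -- In this combination the sums over `k < N` cancel: Euler's limit for `log Γ` removes the sum of
  -- `log (z + k + 1)`, the hyperfactorial sum that of `(k + 1) log (k + 1)`, the harmonic number
  -- that of `1 / (k + 1)`. Stirling's formula disposes of `N!`. What is left is the elementary
  -- limit `tendsto_logHyperfactorialMain_sub`.
  have hlim := (((((hS.add hT).sub (hG.const_mul z)).add hA).sub (hγ.const_mul (z ^ 2 / 2))).add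
    (hs.const_mul z)).add_const (logHyperfactorialMain z + z / 2 * Real.log (2 * Real.pi))
  have huniq := tendsto_nhds_unique hlim ((tendsto_logHyperfactorialMain_sub hz).congr' ?_)
  · rw [barnesG_add_one_eq_exp hz]
    congr 1
    linear_combination huniq
  filter_upwards [eventually_ge_atTop 1] with N hN
  have hN0 : (0 : ℝ) < N := by exact_mod_cast hN
  have hfac := log_factorial_eq hN
  have hsum := sum_mul_log_eq hz N
  have hharm : ((harmonic N : ℚ) : ℝ) = ∑ k ∈ Finset.range N, ((k : ℝ) + 1)⁻¹ := by
    rw [harmonic]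
    push_cast
    rfl
  have hfactor : ∑ k ∈ Finset.range N, (((k : ℝ) + 1) * Real.log (1 + z / ((k : ℝ) + 1)) - z +
      z ^ 2 / (2 * ((k : ℝ) + 1))) =
      ∑ k ∈ Finset.range N, (z + k + 1) * Real.log (z + k + 1) -
        z * ∑ k ∈ Finset.range N, Real.log (z + k + 1) -
        ∑ k ∈ Finset.range N, ((k : ℝ) + 1) * Real.log ((k : ℝ) + 1) - N * z +
        z ^ 2 / 2 * ∑ k ∈ Finset.range N, ((k : ℝ) + 1)⁻¹ := by
    have hconst : (N : ℝ) * z = ∑ k ∈ Finset.range N, z := by simp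
    rw [hconst, Finset.mul_sum, Finset.mul_sum, ← Finset.sum_sub_distrib, ← Finset.sum_sub_distrib,
      ← Finset.sum_sub_distrib, ← Finset.sum_add_distrib]
    refine Finset.sum_congr rfl fun k _ => ?_
    have hk0 : (0 : ℝ) < (k : ℝ) + 1 := by positivity
    have hlog : Real.log (1 + z / ((k : ℝ) + 1)) =
        Real.log (z + k + 1) - Real.log ((k : ℝ) + 1) := by
      rw [← Real.log_div (by positivity) (by positivity)]
      congr 1
      field_simp
      ring
    rw [hlog]
    field_simp
    ring
  have hgam : Real.BohrMollerup.logGammaSeq (z + 1) N = (z + 1) * Real.log N +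
      Real.log N.factorial - (∑ k ∈ Finset.range N, Real.log (z + k + 1) +
        Real.log (z + 1 + N)) := by
    rw [Real.BohrMollerup.logGammaSeq, Finset.sum_range_succ]
    simp only [add_right_comm]
  rw [hfactor, hgam, hfac, hharm, hsum]
  ring

theorem barnesG_quotient_rpow {z r : ℝ} (hz : 0 < z) :
    (barnesG (z + 1) / (glaisherKinkelin⁻¹ * z ^ (-(z ^ 2 / 2) - z / 2 - 1 / 12) *
      Real.exp (z ^ 2 / 4) * Real.Gamma (z + 1) ^ z)) ^ r =
      Real.exp (r * -∑' k : ℕ, bernoulliIntegral 1 0 (z + k)) := by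
  have hden : glaisherKinkelin⁻¹ * z ^ (-(z ^ 2 / 2) - z / 2 - 1 / 12) *
      Real.exp (z ^ 2 / 4) * Real.Gamma (z + 1) ^ z =
      Real.exp (z * Real.log (Real.Gamma (z + 1)) - logHyperfactorialMain z -
        Real.log glaisherKinkelin) := by
    rw [Real.rpow_def_of_pos hz, Real.rpow_def_of_pos (Real.Gamma_pos_of_pos (by linarith))]
    nth_rewrite 1 [← Real.exp_log glaisherKinkelin_pos]
    rw [← Real.exp_neg, ← Real.exp_add, ← Real.exp_add, ← Real.exp_add, logHyperfactorialMain]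
    congr 1
    ring
  rw [hden, barnesG_add_one_eq hz, ← Real.exp_sub, ← Real.exp_mul]
  congr 1
  ring

/-! ### The coefficients `b_n(r)` as a formal exponential -/

/-- The coefficients of the expansion of the logarithm of the `r`-th power of the Barnes quotient
in powers of `1 / z ^ 2`. -/
def logBarnesCoeff (r : ℝ) (k : ℕ) : ℝ := r * eulerMaclaurinCoeff 1 (2 * k)

theorem isBarnesCoeff_expCoeff (r : ℝ) : IsBarnesCoeff r (expCoeff (logBarnesCoeff r)) := by
  refine ⟨expCoeff_zero _, ?_⟩
  have h1 : HasAsymptoticExpansion atTop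
      (fun z : ℝ => -∑' k : ℕ, bernoulliIntegral 1 0 (z + (0 : ℕ) + k)) (fun z => z)
      (eulerMaclaurinCoeff 1) :=
    -- The tails of the convergent remainder series, with a minus sign, solve the difference
    -- equation and tend to `0`.
    hasAsymptoticExpansion_of_sub_eq_bernoulliIntegral
      (h := fun z n => -∑' k : ℕ, bernoulliIntegral 1 0 (z + n + k))
      (show Tendsto (fun z : ℝ => z) atTop atTop from tendsto_id) <| by
      filter_upwards [eventually_gt_atTop 0] with z hz
      refine ⟨fun n => ?_, ?_⟩
      · have h := (summable_bernoulliIntegral_one (show 0 < z + n by positivity)).tsum_eq_zero_add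
        rw [h]
        have : ∀ k : ℕ, z + (n + 1 : ℕ) + (k : ℝ) = z + n + (k + 1 : ℕ) := fun k => by
          push_cast
          ring
        simp only [this, Nat.cast_zero, add_zero]
        ring
      · have h := (tendsto_sum_nat_add fun k : ℕ => bernoulliIntegral 1 0 (z + k)).neg
        rw [neg_zero] at h
        refine h.congr fun n => ?_
        congr 1
        refine tsum_congr fun k => ?_
        congr 1
        push_cast
        ring
  have hx : Tendsto (fun z : ℝ => z ^ 2) atTop atTop := tendsto_pow_atTop two_ne_zero
  have h2 := ((h1.sq eulerMaclaurinCoeff_one_odd).const_mul r).exp hx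
    (by rw [mul_zero]; simp [eulerMaclaurinCoeff])
  refine h2.congr' ?_
  filter_upwards [eventually_gt_atTop 0] with z hz
  rw [barnesG_quotient_rpow hz]
  simp

theorem expCoeff_pow_mul (a : ℕ → ℝ) (s : ℝ) (n : ℕ) :
    expCoeff (fun k => s ^ k * a k) n = s ^ n * expCoeff a n := by
  induction n using Nat.strong_induction_on with
  | _ n ih =>
    rcases n with _ | n
    · simp [expCoeff_zero]
    · have hpos : (n : ℝ) + 1 ≠ 0 := by positivity
      refine mul_left_cancel₀ hpos ?_
      rw [expCoeff_succ, mul_left_comm, expCoeff_succ, Finset.mul_sum]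
      refine Finset.sum_congr rfl fun p hp => ?_
      have hp' := Finset.HasAntidiagonal.mem_antidiagonal.mp hp
      rw [ih p.2 (by omega), ← hp']
      ring

theorem HasAsymptoticExpansion.congr_variable {α : Type*} {l : Filter α} {f x y : α → ℝ}
    {a : ℕ → ℝ} (h : HasAsymptoticExpansion l f x a) (hxy : x =ᶠ[l] y) :
    HasAsymptoticExpansion l f y a := fun m =>
  (h m).congr' (hxy.mono fun t ht => by simp only [ht]) (hxy.mono fun t ht => by simp only [ht])

/-! ### Inverse falling factorials and Stirling numbers -/

/-- The coefficients of the expansion of `1 / (N (N - 1) ⋯ (N - K))` in powers of `1 / N`. -/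
def invDescFactorialCoeff (K : ℕ) : ℕ → ℝ
  | 0 => 0
  | j + 1 => Nat.stirlingSecond j K

theorem invDescFactorialCoeff_succ_succ (K j : ℕ) :
    invDescFactorialCoeff (K + 1) (j + 1) =
      invDescFactorialCoeff K j + (K + 1) * invDescFactorialCoeff (K + 1) j := by
  rcases j with _ | j
  · simp [invDescFactorialCoeff]
  · simp only [invDescFactorialCoeff]
    rw [Nat.stirlingSecond_succ_succ]
    push_cast
    ring

theorem hasAsymptoticExpansion_inv_descFactorial (K : ℕ) :
    HasAsymptoticExpansion atTop (fun N : ℕ => ((N - 1 - K).factorial : ℝ) / N.factorial)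
      (fun N : ℕ => (N : ℝ)) (invDescFactorialCoeff K) := by
  induction K with
  | zero =>
    intro m
    have hev : ∀ᶠ N : ℕ in atTop, ((N - 1 - 0).factorial : ℝ) / N.factorial = 1 / N := by
      filter_upwards [eventually_ge_atTop 1] with N hN
      have hN0 : (0 : ℝ) < N := by exact_mod_cast hN
      rw [← Nat.mul_factorial_pred (show N ≠ 0 by omega), Nat.sub_zero]
      push_cast
      field_simp
    rcases m with _ | _ | m
    · refine IsBigO.of_bound 1 ?_
      filter_upwards [hev, eventually_ge_atTop 1] with N hN hN1
      have hN1' : (1 : ℝ) ≤ N := by exact_mod_cast hN1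
      rw [hN]
      simpa using inv_le_one_of_one_le₀ hN1'
    · refine (isBigO_refl (fun N : ℕ => 1 / (N : ℝ) ^ 1) atTop).congr' ?_ EventuallyEq.rfl
      filter_upwards [hev] with N hN
      simp only [hN]
      simp [invDescFactorialCoeff]
    · refine (isBigO_zero _ _).congr' ?_ EventuallyEq.rfl
      filter_upwards [hev] with N hN
      rw [hN, Finset.sum_range_succ', Finset.sum_range_succ', Finset.sum_eq_zero]
      · simp [invDescFactorialCoeff]
      · intro k _
        simp [invDescFactorialCoeff]
  | succ K ih =>
    -- With `f_K` the function to be expanded, `f_K = (N - K - 1) f_{K+1}` rearranges to `f_{K+1} =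
    -- (f_K + (K + 1) f_{K+1}) / N`. On coefficients this is the recurrence of the Stirling numbers;
    -- the factor `1 / N` gains one order at each step of the inner induction.
    have hrec : ∀ᶠ N : ℕ in atTop, ((N - 1 - (K + 1)).factorial : ℝ) / N.factorial =
        1 / N * (((N - 1 - K).factorial : ℝ) / N.factorial +
          (K + 1) * (((N - 1 - (K + 1)).factorial : ℝ) / N.factorial)) := by
      filter_upwards [eventually_ge_atTop (K + 2)] with N hN
      have hN0 : (0 : ℝ) < N := by exact_mod_cast (show 0 < N by omega)
      obtain ⟨c, rfl⟩ := Nat.exists_eq_add_of_le hN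
      rw [show K + 2 + c - 1 - K = c + 1 by omega, show K + 2 + c - 1 - (K + 1) = c by omega,
        Nat.factorial_succ c]
      push_cast at hN0 ⊢
      field_simp
      ring
    intro m
    induction m with
    | zero =>
      refine IsBigO.of_bound 1 (Eventually.of_forall fun N => ?_)
      simp only [Finset.range_zero, Finset.sum_empty, sub_zero, pow_zero, div_one, norm_one,
        mul_one]
      rw [Real.norm_of_nonneg (by positivity), div_le_one (by positivity)]
      exact_mod_cast Nat.factorial_le (by omega)
    | succ m ihm =>
      have h := (isBigO_refl (fun N : ℕ => 1 / (N : ℝ)) atTop).mul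
        ((ih m).add (ihm.const_mul_left ((K : ℝ) + 1)))
      refine h.congr' ?_ (Eventually.of_forall fun N => ?_)
      · filter_upwards [hrec, eventually_ge_atTop 1] with N hN hN1
        have hN0 : (0 : ℝ) < N := by exact_mod_cast hN1
        have hsum : ∑ k ∈ Finset.range (m + 1), invDescFactorialCoeff (K + 1) k / (N : ℝ) ^ k =
            1 / N * (∑ k ∈ Finset.range m, invDescFactorialCoeff K k / (N : ℝ) ^ k +
              (K + 1) * ∑ k ∈ Finset.range m, invDescFactorialCoeff (K + 1) k / (N : ℝ) ^ k) := by
          rw [Finset.sum_range_succ', Finset.mul_sum, ← Finset.sum_add_distrib, Finset.mul_sum]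
          rw [show invDescFactorialCoeff (K + 1) 0 = 0 from rfl, zero_div, add_zero]
          refine Finset.sum_congr rfl fun k _ => ?_
          rw [invDescFactorialCoeff_succ_succ, pow_succ]
          field_simp
        rw [hsum]
        linear_combination -hN
      · simp only [pow_succ]
        field_simp

/-! ### Zeta values and the growth of `b_n(r)` -/

/-- `ζ (2 k + 2) - 1 = O(4 ^ (-k))`. -/
theorem exists_abs_zeta_sub_one_le : ∃ C : ℝ, 0 ≤ C ∧ ∀ k : ℕ,
    |(∑' n : ℕ, 1 / (n : ℝ) ^ (2 * (k + 1))) - 1| ≤ C * (1 / 4) ^ k := by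
  have hsum : ∀ k : ℕ, Summable fun n : ℕ => 1 / ((n : ℝ) + 2) ^ (2 * (k + 1)) := fun k => by
    have := (summable_nat_add_iff 2).mpr
      (Real.summable_one_div_nat_pow.mpr (show 1 < 2 * (k + 1) by omega))
    simpa using this
  refine ⟨∑' n : ℕ, 1 / ((n : ℝ) + 2) ^ (2 * (0 + 1)), tsum_nonneg fun n => by positivity,
    fun k => ?_⟩
  have h1 := (Real.summable_one_div_nat_pow.mpr
    (show 1 < 2 * (k + 1) by omega)).sum_add_tsum_nat_add 2
  have h2 : (∑' n : ℕ, 1 / (n : ℝ) ^ (2 * (k + 1))) - 1 =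
      ∑' n : ℕ, 1 / ((n : ℝ) + 2) ^ (2 * (k + 1)) := by
    rw [← h1, Finset.sum_range_succ, Finset.sum_range_one]
    simp
  rw [h2, abs_of_nonneg (tsum_nonneg fun n => by positivity), ← tsum_mul_right]
  refine (hsum k).tsum_le_tsum (fun n => ?_) ((hsum 0).mul_right _)
  have h3 : ((1 : ℝ) / 4) ^ k = 1 / (2 : ℝ) ^ (2 * k) := by
    rw [pow_mul, one_div_pow]
    norm_num
  rw [h3, div_mul_div_comm, one_mul, mul_add, pow_add, mul_comm (((n : ℝ) + 2) ^ (2 * k))]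
  gcongr
  linarith [n.cast_nonneg (α := ℝ)]

/-- Euler's formula for `ζ(2k + 2)`. The scaling by `(2π) ^ (2k)` isolates the factorial growth and
the sign. -/
theorem logBarnesCoeff_eq (r : ℝ) {k : ℕ} (hk : 1 ≤ k) :
    ((2 * Real.pi) ^ 2) ^ k * logBarnesCoeff r k =
      r / (2 * Real.pi ^ 2) * (-1) ^ k * (2 * k - 1).factorial *
        ∑' n : ℕ, 1 / (n : ℝ) ^ (2 * (k + 1)) := by
  obtain ⟨j, rfl⟩ := Nat.exists_eq_add_of_le' hk
  rw [(hasSum_zeta_nat (show j + 1 + 1 ≠ 0 by omega)).tsum_eq, logBarnesCoeff,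
    show 2 * (j + 1) = 2 * j + 1 + 1 by ring, eulerMaclaurinCoeff,
    show 2 * j + 1 + 1 + 2 = 2 * (j + 1 + 1) by ring,
    show 2 * (j + 1 + 1) - 1 = 2 * j + 3 by omega]
  have hsq : (-1 : ℝ) ^ (j + 1) * (-1) ^ (j + 1 + 1 + 1) = 1 := by
    rw [← pow_add, show j + 1 + (j + 1 + 1 + 1) = 2 * (j + 2) by ring, pow_mul]
    norm_num
  have hπ := Real.pi_ne_zero
  calc _ = r * ((2 * j + 1).factorial * bernoulli (2 * (j + 1 + 1)) /
        (2 * (j + 1 + 1)).factorial) * (2 ^ (2 * j + 2) * Real.pi ^ (2 * j + 2)) := by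
        rw [← pow_mul, mul_pow]
        ring_nf
    _ = r * ((2 * j + 1).factorial * bernoulli (2 * (j + 1 + 1)) /
        (2 * (j + 1 + 1)).factorial) * (2 ^ (2 * j + 2) * Real.pi ^ (2 * j + 2)) *
          ((-1 : ℝ) ^ (j + 1) * (-1) ^ (j + 1 + 1 + 1)) := by rw [hsq, mul_one]
    _ = _ := by
        rw [show 2 * j + 1 + 1 - 1 = 2 * j + 1 by omega,
          show 2 * (j + 1 + 1) = 2 * j + 2 + 2 by ring, pow_add Real.pi (2 * j + 2) 2,
          show 2 * j + 3 = 2 * j + 2 + 1 by ring, pow_succ (2 : ℝ) (2 * j + 2)]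
        field_simp

/-- The single-large-index approximation for the scaled series, with each `ζ(2(n - ν) + 2)` replaced
by `1`; the geometric error of this replacement is below every power of `1 / n`. -/
theorem expCoeff_logBarnesCoeff_isBigO (r : ℝ) (M : ℕ) :
    (fun n : ℕ => ((2 * Real.pi) ^ 2) ^ n * expCoeff (logBarnesCoeff r) n -
      r / (2 * Real.pi ^ 2) * (-1) ^ n * ∑ ν ∈ Finset.range M, (-1) ^ ν *
        (2 * n - 2 * ν - 1).factorial *
          (((2 * Real.pi) ^ 2) ^ ν * expCoeff (logBarnesCoeff r) ν)) =O[atTop]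
      fun n : ℕ => ((2 * n - 1).factorial : ℝ) / (n : ℝ) ^ (2 * M) := by
  obtain ⟨C, hC0, hC⟩ := exists_abs_zeta_sub_one_le
  set s := (2 * Real.pi) ^ 2
  set c := r / (2 * Real.pi ^ 2) with hc
  set Z : ℕ → ℝ := fun k => ∑' n : ℕ, 1 / (n : ℝ) ^ (2 * (k + 1)) with hZ
  have hbound : ∀ k, 1 ≤ k → |s ^ k * logBarnesCoeff r k| ≤
      |c| * (1 + C) * (2 * k - 1).factorial := fun k hk => by
    have hZk : |Z k| ≤ 1 + C := by
      have h1 : |Z k - 1| ≤ C := (hC k).trans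
        (mul_le_of_le_one_right hC0 (pow_le_one₀ (by norm_num) (by norm_num)))
      calc |Z k| = |1 + (Z k - 1)| := by ring_nf
        _ ≤ |1| + |Z k - 1| := abs_add_le _ _
        _ ≤ 1 + C := by rw [abs_one]; linarith
    rw [logBarnesCoeff_eq r hk, abs_mul, abs_mul, abs_mul, abs_pow, abs_neg, abs_one, one_pow,
      mul_one, Nat.abs_cast]
    calc |c| * (2 * k - 1).factorial * |Z k| ≤ |c| * (2 * k - 1).factorial * (1 + C) := by gcongr
      _ = _ := by ring
  have h1 := expCoeff_sub_sum_isBigO hbound M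
  simp only [expCoeff_pow_mul] at h1
  have h2 : ∀ ν ∈ Finset.range M, (fun n : ℕ => (s ^ (n - ν) * logBarnesCoeff r (n - ν) -
      c * (-1) ^ n * ((-1) ^ ν * (2 * n - 2 * ν - 1).factorial)) *
        (s ^ ν * expCoeff (logBarnesCoeff r) ν)) =O[atTop]
      fun n : ℕ => ((2 * n - 1).factorial : ℝ) / (n : ℝ) ^ (2 * M) := fun ν hν => by
    have hνM := Finset.mem_range.mp hν
    have hs : Summable fun n : ℕ => (n : ℝ) ^ (2 * M) * (1 / 4) ^ n :=
      summable_pow_mul_geometric_of_norm_lt_one (R := ℝ) (2 * M) (by norm_num)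
    refine IsBigO.of_bound (|c| * C * 4 ^ ν * (∑' n : ℕ, (n : ℝ) ^ (2 * M) * (1 / 4) ^ n) *
      |s ^ ν * expCoeff (logBarnesCoeff r) ν|) ?_
    filter_upwards [eventually_ge_atTop (2 * M + 1)] with n hn
    have hn0 : (0 : ℝ) < n := by exact_mod_cast (show 0 < n by omega)
    have hsign : (-1 : ℝ) ^ n * (-1) ^ ν = (-1) ^ (n - ν) := by
      obtain ⟨j, rfl⟩ := Nat.exists_eq_add_of_le (show ν ≤ n by omega)
      rw [Nat.add_sub_cancel_left, pow_add, mul_right_comm, ← pow_add, ← two_mul, pow_mul]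
      norm_num
    have heq : s ^ (n - ν) * logBarnesCoeff r (n - ν) -
        c * (-1) ^ n * ((-1) ^ ν * (2 * n - 2 * ν - 1).factorial) =
        c * (-1) ^ (n - ν) * (2 * n - 2 * ν - 1).factorial * (Z (n - ν) - 1) := by
      rw [logBarnesCoeff_eq r (show 1 ≤ n - ν by omega), ← hsign, Nat.mul_sub]
      ring
    have hfac : ((2 * n - 2 * ν - 1).factorial : ℝ) ≤ (2 * n - 1).factorial := by
      exact_mod_cast Nat.factorial_le (by omega)
    have hpow : ((1 : ℝ) / 4) ^ (n - ν) = 4 ^ ν * (1 / 4) ^ n := by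
      obtain ⟨j, rfl⟩ := Nat.exists_eq_add_of_le (show ν ≤ n by omega)
      rw [Nat.add_sub_cancel_left, pow_add, ← mul_assoc, ← mul_pow]
      norm_num
    have hgeo : (1 / 4 : ℝ) ^ n ≤ (∑' n : ℕ, (n : ℝ) ^ (2 * M) * (1 / 4) ^ n) / n ^ (2 * M) := by
      rw [le_div_iff₀ (by positivity), mul_comm]
      exact hs.le_tsum n fun i _ => by positivity
    rw [heq, Real.norm_eq_abs, Real.norm_of_nonneg (by positivity), abs_mul, abs_mul, abs_mul,
      abs_mul, abs_pow, abs_neg, abs_one, one_pow, mul_one, Nat.abs_cast]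
    calc |c| * (2 * n - 2 * ν - 1).factorial * |Z (n - ν) - 1| *
          |s ^ ν * expCoeff (logBarnesCoeff r) ν|
        ≤ |c| * (2 * n - 1).factorial * (C * (4 ^ ν *
          ((∑' n : ℕ, (n : ℝ) ^ (2 * M) * (1 / 4) ^ n) / n ^ (2 * M)))) *
            |s ^ ν * expCoeff (logBarnesCoeff r) ν| := by
          gcongr
          refine (hC (n - ν)).trans ?_
          rw [hpow]
          gcongr
      _ = _ := by ring
  refine (h1.add (IsBigO.fun_sum h2)).congr_left fun n => ?_
  simp only [sub_mul]
  rw [Finset.sum_sub_distrib, Finset.mul_sum]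
  have : ∀ ν, c * (-1) ^ n * ((-1) ^ ν * (2 * n - 2 * ν - 1).factorial *
      (s ^ ν * expCoeff (logBarnesCoeff r) ν)) = c * (-1) ^ n * ((-1) ^ ν *
        (2 * n - 2 * ν - 1).factorial) * (s ^ ν * expCoeff (logBarnesCoeff r) ν) := fun ν => by
    ring
  simp only [this]
  ring

/-- The leading factor is `(2n - 1)` times Stirling's leading approximation to `(2n - 2)!`, up to
constants and scaling. The constants leave the `1 / 4` that becomes `I_{0,n}`. The bound on `n`
keeps `2n - 2` positive. -/
theorem leadingFactor_mul_stirling (r : ℝ) {n : ℕ} (hn : 2 ≤ n) :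
    ((2 * Real.pi) ^ 2) ^ n * leadingFactor r n * (((2 * n - 2).factorial : ℝ) /
      ((((2 * n - 2 : ℕ) : ℝ) / Real.exp 1) ^ (2 * n - 2) *
        Real.sqrt (2 * Real.pi * ((2 * n - 2 : ℕ) : ℝ)))) / 4 =
      r / (2 * Real.pi ^ 2) * (-1) ^ n * (2 * n - 1).factorial := by
  obtain ⟨t, rfl⟩ := Nat.exists_eq_add_of_le' (show 1 ≤ n by omega)
  have ht0 : (0 : ℝ) < t := by exact_mod_cast (show 0 < t by omega)
  have hπ := Real.pi_pos
  have he := Real.exp_pos 1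
  have hs1 : Real.sqrt (2 * Real.pi * ((2 * t : ℕ) : ℝ)) = 2 * Real.sqrt (Real.pi * t) := by
    rw [show 2 * Real.pi * ((2 * t : ℕ) : ℝ) = 2 ^ 2 * (Real.pi * t) by push_cast; ring,
      Real.sqrt_mul (by norm_num), Real.sqrt_sq (by norm_num)]
  have hs2 : Real.sqrt ((t : ℝ) / Real.pi ^ 7) = Real.sqrt (Real.pi * t) / Real.pi ^ 4 := by
    rw [show (t : ℝ) / Real.pi ^ 7 = Real.pi * t / (Real.pi ^ 4) ^ 2 by field_simp,
      Real.sqrt_div (by positivity), Real.sqrt_sq (by positivity)]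
  rw [leadingFactor, show 2 * (t + 1) - 2 = 2 * t by omega,
    show 2 * (t + 1) - 1 = 2 * t + 1 by omega, Nat.factorial_succ (2 * t), hs1]
  push_cast
  rw [show (t : ℝ) + 1 - 1 = t by ring, hs2, div_pow, div_pow, mul_pow (2 : ℝ) t,
    mul_pow Real.pi (Real.exp 1), pow_succ _ t, ← pow_mul, mul_pow 2 Real.pi (2 * t)]
  have hsq : 0 < Real.sqrt (Real.pi * t) := by positivity
  generalize Real.sqrt (Real.pi * t) = q at hsq
  field_simp
  ring

/-! ### Assembly of the expansion -/

/-- The combination of Stirling coefficients, Stirling numbers and Barnes coefficients in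
`coeffI` as a Cauchy product. -/
theorem coeffI_eq {γ b : ℕ → ℝ} (hγ : γ 0 = 1) {M k : ℕ} (hk : k < M) (n : ℕ) :
    coeffI γ b k n = 1 / 4 * ((1 / 2) ^ k * γ k) + 1 / (2 * (n : ℝ) - 1) * (1 / 4) *
      ((1 / 2) ^ k * ∑ p ∈ Finset.HasAntidiagonal.antidiagonal k, γ p.1 *
        ∑ ν ∈ Finset.Ico 1 M, (-1) ^ ν * (((2 * Real.pi) ^ 2) ^ ν * b ν) *
          invDescFactorialCoeff (2 * ν - 2) p.2) := by
  rw [coeffI]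
  split_ifs with hk0
  · subst hk0
    simp [hγ, invDescFactorialCoeff]
  have hanti : ∀ F : ℕ → ℕ → ℝ, (∀ i, F i 0 = 0) →
      ∑ p ∈ Finset.HasAntidiagonal.antidiagonal k, F p.1 p.2 =
        ∑ j ∈ Finset.Icc 1 k, F (k - j) j := fun F hF => by
    rw [← Finset.Nat.sum_antidiagonal_swap]
    simp only [Prod.fst_swap, Prod.snd_swap]
    rw [Finset.Nat.sum_antidiagonal_eq_sum_range_succ (fun i j => F j i) k,
      Finset.range_eq_Ico, Finset.sum_eq_sum_Ico_succ_bot (Nat.succ_pos k), hF, zero_add]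
    rfl
  rw [hanti (fun i j => γ i * ∑ ν ∈ Finset.Ico 1 M, (-1) ^ ν *
    (((2 * Real.pi) ^ 2) ^ ν * b ν) * invDescFactorialCoeff (2 * ν - 2) j)
    (fun i => by simp [invDescFactorialCoeff])]
  have hmain : ∑ j ∈ Finset.Icc 1 k, ∑ ν ∈ Finset.Icc 1 ((j + 1) / 2),
      (-1 : ℝ) ^ ν * (2 : ℝ) ^ (2 * (ν : ℤ) - (k : ℤ) - 2) * Real.pi ^ (2 * ν) * b ν * γ (k - j) *
        (Nat.stirlingSecond (j - 1) (2 * ν - 2) : ℝ) =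
      1 / 4 * ((1 / 2) ^ k * ∑ j ∈ Finset.Icc 1 k, γ (k - j) *
        ∑ ν ∈ Finset.Ico 1 M, (-1) ^ ν * (((2 * Real.pi) ^ 2) ^ ν * b ν) *
          invDescFactorialCoeff (2 * ν - 2) j) := by
    simp only [Finset.mul_sum]
    refine Finset.sum_congr rfl fun j hj => ?_
    obtain ⟨hj1, hjk⟩ := Finset.mem_Icc.mp hj
    obtain ⟨i, rfl⟩ := Nat.exists_eq_add_of_le' hj1
    simp only [invDescFactorialCoeff, Nat.add_sub_cancel]
    have hsub : Finset.Icc 1 ((i + 1 + 1) / 2) ⊆ Finset.Ico 1 M := fun ν hν => by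
      have := Finset.mem_Icc.mp hν
      exact Finset.mem_Ico.mpr (by omega)
    -- The terms with `ν > (i + 2) / 2` have `2ν - 2 > i` and a vanishing Stirling number, so the
    -- cutoff `M` does not affect the sum.
    rw [← Finset.sum_subset hsub]
    · refine Finset.sum_congr rfl fun ν _ => ?_
      have h2 : (2 : ℝ) ^ (2 * (ν : ℤ) - (k : ℤ) - 2) = 2 ^ (2 * ν) / (2 ^ k * 4) := by
        rw [zpow_sub₀ two_ne_zero, zpow_sub₀ two_ne_zero, zpow_natCast, div_div]
        norm_cast
      rw [h2, ← pow_mul, mul_pow, one_div_pow]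
      field_simp
    · intro ν hν hν'
      have h1 := Finset.mem_Ico.mp hν
      have h2 : ¬ (ν ≤ (i + 1 + 1) / 2) := fun h => hν' (Finset.mem_Icc.mpr ⟨h1.1, h⟩)
      rw [Nat.stirlingSecond_eq_zero_of_lt (by omega)]
      simp
  rw [hmain, pow_add, one_div_pow]
  ring

theorem barnesCoeff_asymptotic {r : ℝ} (hr : r ≠ 0) {γ : ℕ → ℝ} (hγ : IsStirlingCoeff γ)
    (hγ0 : γ 0 = 1) (m : ℕ) :
    (fun n : ℕ => expCoeff (logBarnesCoeff r) n - leadingFactor r n *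
      ∑ k ∈ Finset.range m, coeffI γ (expCoeff (logBarnesCoeff r)) k n / ((n : ℝ) - 1) ^ k)
      =O[atTop] fun n : ℕ => leadingFactor r n * (1 / ((n : ℝ) - 1) ^ m) := by
  set b := expCoeff (logBarnesCoeff r) with hb
  set s := (2 * Real.pi) ^ 2 with hs
  set c := r / (2 * Real.pi ^ 2) with hc
  -- Large enough for `coeffI_eq` at every `k < m`, and positive, so that the term `ν = 0` is always
  -- present.
  set M := m + 1 with hM
  have hπ := Real.pi_pos
  have hs0 : 0 < s := by positivity
  have hc0 : c ≠ 0 := div_ne_zero hr (by positivity)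
  set S : ℕ → ℝ := fun n => ((2 * n - 2).factorial : ℝ) /
      ((((2 * n - 2 : ℕ) : ℝ) / Real.exp 1) ^ (2 * n - 2) *
        Real.sqrt (2 * Real.pi * ((2 * n - 2 : ℕ) : ℝ))) with hS
  set R : ℕ → ℝ := fun n => ∑ ν ∈ Finset.Ico 1 M, (-1) ^ ν * (s ^ ν * b ν) *
    (((2 * n - 2 - 1 - (2 * ν - 2)).factorial : ℝ) / (2 * n - 2).factorial) with hR
  set d : ℕ → ℝ := fun k => ∑ p ∈ Finset.HasAntidiagonal.antidiagonal k, γ p.1 *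
        ∑ ν ∈ Finset.Ico 1 M, (-1) ^ ν * (s ^ ν * b ν) *
          invDescFactorialCoeff (2 * ν - 2) p.2 with hd
  have htop : Tendsto (fun n : ℕ => 2 * n - 2) atTop atTop :=
    tendsto_atTop_mono (fun n => show n - 2 ≤ 2 * n - 2 by omega) (tendsto_sub_atTop_nat 2)
  have hvar : (fun n : ℕ => 1 / 2 * ((2 * n - 2 : ℕ) : ℝ)) =ᶠ[atTop] fun n : ℕ => (n : ℝ) - 1 := by
    filter_upwards [eventually_ge_atTop 1] with n hn
    rw [Nat.cast_sub (by omega)]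
    push_cast
    ring
  have hSexp : HasAsymptoticExpansion atTop S (fun n : ℕ => ((2 * n - 2 : ℕ) : ℝ)) γ :=
    HasAsymptoticExpansion.comp_tendsto hγ htop
  have hRexp : HasAsymptoticExpansion atTop R (fun n : ℕ => ((2 * n - 2 : ℕ) : ℝ))
      (fun k => ∑ ν ∈ Finset.Ico 1 M, (-1) ^ ν * (s ^ ν * b ν) *
        invDescFactorialCoeff (2 * ν - 2) k) :=
    HasAsymptoticExpansion.sum _ fun ν _ =>
      ((hasAsymptoticExpansion_inv_descFactorial (2 * ν - 2)).comp_tendsto htop).const_mul _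
  have hSRexp := hSexp.mul hRexp (tendsto_natCast_atTop_atTop.comp htop)
  have h1 := ((hSexp.const_mul_variable one_half_pos).congr_variable hvar) m
  have h2 := ((hSRexp.const_mul_variable one_half_pos).congr_variable hvar) m
  -- The factor `1 / (2n - 1)` is kept exact rather than expanded, which is why `I_{k,n}` depends on
  -- `n`; in the error terms boundedness is enough.
  have hinv : (fun n : ℕ => 1 / (2 * (n : ℝ) - 1)) =O[atTop] fun _ => (1 : ℝ) := by
    refine IsBigO.of_bound 1 ?_
    filter_upwards [eventually_ge_atTop 1] with n hn
    have hn1 : (1 : ℝ) ≤ n := by exact_mod_cast hn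
    rw [Real.norm_of_nonneg (one_div_nonneg.mpr (by linarith)), norm_one, mul_one,
      div_le_one (by linarith)]
    linarith
  set err : ℕ → ℝ := fun n => s ^ n * b n - c * (-1) ^ n * ∑ ν ∈ Finset.range M, (-1) ^ ν *
    (2 * n - 2 * ν - 1).factorial * (s ^ ν * b ν) with herr
  have herrO : err =O[atTop] fun n : ℕ => ((2 * n - 1).factorial : ℝ) / (n : ℝ) ^ (2 * M) :=
    expCoeff_logBarnesCoeff_isBigO r M
  have h3 : (fun n : ℕ => S n * (err n * (1 / (4 * c * (-1) ^ n * (2 * n - 1).factorial))))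
      =O[atTop] fun n : ℕ => 1 / ((n : ℝ) - 1) ^ m := by
    have h4 : (fun n : ℕ => err n * (1 / (4 * c * (-1) ^ n * (2 * n - 1).factorial))) =O[atTop]
        fun n : ℕ => 1 / (n : ℝ) ^ (2 * M) := by
      have h5 : (fun n : ℕ => 1 / (4 * c * (-1) ^ n * (2 * n - 1).factorial)) =O[atTop]
          fun n : ℕ => 1 / ((2 * n - 1).factorial : ℝ) := by
        refine IsBigO.of_bound (1 / (4 * |c|)) (Eventually.of_forall fun n => le_of_eq ?_)
        simp
        ring
      refine (herrO.mul h5).congr_right fun n => ?_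
      field_simp
    have h6 : (fun n : ℕ => 1 / (n : ℝ) ^ (2 * M)) =O[atTop]
        fun n : ℕ => 1 / ((n : ℝ) - 1) ^ m := by
      refine IsBigO.of_bound 1 ?_
      filter_upwards [eventually_ge_atTop 2] with n hn
      have hn1 : (2 : ℝ) ≤ n := by exact_mod_cast hn
      have hn2 : 0 < (n : ℝ) - 1 := by linarith
      rw [one_mul, Real.norm_of_nonneg (by positivity), Real.norm_of_nonneg (by positivity)]
      refine one_div_le_one_div_of_le (by positivity) ?_
      exact (pow_le_pow_left₀ hn2.le (by linarith) m).trans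
        (pow_le_pow_right₀ (by linarith) (by omega))
    simpa using hSexp.isBigO_one.mul (h4.trans h6)
  have h4 := ((h1.const_mul_left (1 / 4)).add
    ((hinv.mul (h2.const_mul_left (1 / 4))).congr_right fun n => one_mul _)).add h3
  refine ((isBigO_refl (leadingFactor r) atTop).mul h4).congr' ?_ EventuallyEq.rfl
  filter_upwards [eventually_ge_atTop (M + 1)] with n hn
  have hn1 : (1 : ℝ) ≤ n := by exact_mod_cast (show 1 ≤ n by omega)
  have h21 : 2 * (n : ℝ) - 1 ≠ 0 := by linarith
  have hlead : s ^ n * leadingFactor r n * S n / 4 = c * (-1) ^ n * (2 * n - 1).factorial :=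
    leadingFactor_mul_stirling r (by omega)
  have hcoeff : ∑ k ∈ Finset.range m, coeffI γ b k n / ((n : ℝ) - 1) ^ k =
      1 / 4 * ∑ k ∈ Finset.range m, (1 / 2) ^ k * γ k / ((n : ℝ) - 1) ^ k +
        1 / (2 * (n : ℝ) - 1) * (1 / 4) *
          ∑ k ∈ Finset.range m, (1 / 2) ^ k * d k / ((n : ℝ) - 1) ^ k := by
    rw [Finset.mul_sum, Finset.mul_sum, ← Finset.sum_add_distrib]
    refine Finset.sum_congr rfl fun k hk => ?_
    rw [coeffI_eq hγ0 (show k < M by have := Finset.mem_range.mp hk; omega)]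
    ring
  have hfac : ((2 * n - 1).factorial : ℝ) = (2 * n - 1) * (2 * n - 2).factorial := by
    rw [← Nat.mul_factorial_pred (show 2 * n - 1 ≠ 0 by omega), Nat.cast_mul,
      Nat.cast_sub (by omega)]
    push_cast
    rfl
  have hsum : ∑ ν ∈ Finset.range M, (-1) ^ ν * (2 * n - 2 * ν - 1).factorial * (s ^ ν * b ν) =
      (2 * n - 1).factorial * (1 + 1 / (2 * (n : ℝ) - 1) * R n) := by
    rw [Finset.range_eq_Ico, Finset.sum_eq_sum_Ico_succ_bot (by omega), hR]
    have hb0 : b 0 = 1 := expCoeff_zero _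
    simp only [pow_zero, one_mul, mul_zero, Nat.sub_zero, zero_add, hb0, mul_one, mul_add,
      Finset.mul_sum]
    congr 1
    refine Finset.sum_congr rfl fun ν hν => ?_
    have := Finset.mem_Ico.mp hν
    rw [show 2 * n - 2 - 1 - (2 * ν - 2) = 2 * n - 2 * ν - 1 by omega, hfac]
    field_simp
  have hbn : s ^ n * b n = c * (-1) ^ n * (2 * n - 1).factorial *
      (1 + 1 / (2 * (n : ℝ) - 1) * R n) + err n := by
    rw [herr]
    simp only
    rw [hsum]
    ring
  have herr' : c * (-1) ^ n * (2 * n - 1).factorial * 4 *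
      (err n * (1 / (4 * c * (-1) ^ n * (2 * n - 1).factorial))) = err n := by
    have : (-1 : ℝ) ^ n ≠ 0 := pow_ne_zero _ (by norm_num)
    field_simp
  rw [hcoeff]
  -- An exact identity: `S` is the Stirling quotient of `(2n - 2)!`, and `S R` carries the terms `1
  -- ≤ ν < M`. All asymptotics are already in `h1`, `h2` and `h3`.
  have hfinal : b n = leadingFactor r n * (1 / 4 * S n + 1 / (2 * (n : ℝ) - 1) * (1 / 4 *
      (S n * R n)) + S n * (err n * (1 / (4 * c * (-1) ^ n * (2 * n - 1).factorial)))) := by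
    refine mul_left_cancel₀ (pow_ne_zero n hs0.ne') ?_
    rw [← herr', ← hlead] at hbn
    rw [hbn]
    ring
  rw [hfinal]
  ring

end

theorem theorem1p2 :
    ∃ γ : ℕ → ℝ, IsStirlingCoeff γ ∧
      ∀ r : ℝ, r ≠ 0 →
        ∃ b : ℕ → ℝ, IsBarnesCoeff r b ∧
          ∀ m : ℕ,
            (fun n : ℕ => b n - leadingFactor r n *
              ∑ k ∈ Finset.range m, coeffI γ b k n / ((n : ℝ) - 1) ^ k)
            =O[atTop] fun n : ℕ => leadingFactor r n * (1 / ((n : ℝ) - 1) ^ m) :=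
  ⟨_, isStirlingCoeff_expCoeff, fun r hr => ⟨_, isBarnesCoeff_expCoeff r,
    barnesCoeff_asymptotic hr isStirlingCoeff_expCoeff (expCoeff_zero _)⟩⟩
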